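/- Let $\mathcal M$ be the set of finite signed Borel measures on $\mathbb R^d$, let $\mathcal M_a\subset\mathcal M$ be those absolutely continuous with respect to Lebesgue measure, and write $p_\mu$ for the Lebesgue density of $\mu\in\mathcal M_a$. Let $\mathcal E$ be the set of functions $e:\mathbb R\to[0,\infty)$ that are symmetric and strictly convex with $e(0)=0$, for which there is $\lambda>0$ with $e(2s)\le\lambda e(s)$ for all $s$, and for which $s\mapsto e(s)/s$ is non-decreasing on $(0,\infty)$. For $e\in\mathcal E$ and measurable $f:\mathbb R^d\to\mathbb R$ put $$\|f\|_{(e)}=\inf\Big\{c>0:\int e\big(\tfrac1c f(x)\big)\,dx\le 1\Big\},\qquad L^e=\{f:\|f\|_{(e)}<\infty\},$$ $$e^{-1}(a)=\sup\{c:e(c)\le a\},\qquad \beta_e(R)=\frac{R}{e^{-1}(R)},$$ $$\|f\|_{k,(e)}=\sum_{|\alpha|\le k}\|\partial_\alpha f\|_{(e)},\qquad W^{k,e}=\{f:\|f\|_{k,(e)}<\infty\},\qquad \|f\|_{k,l,(e)}=\sum_{|\gamma|\le l}\ \sum_{|\alpha|\le k}\|x^\gamma\partial_\alpha f\|_{(e)},$$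 where $\alpha,\gamma\in\mathbb N^d$ are multi-indices and $\partial_\alpha f$ is the weak derivative of the locally integrable function $f$ (a norm is $+\infty$ if one of the weak derivatives in it does not exist as a locally integrable function). For $k\in\mathbb N$ and $\mu,\nu\in\mathcal M$ let $$d_k(\mu,\nu)=\sup\Big\{\Big|\int\phi\,d\mu-\int\phi\,d\nu\Big|:\phi\in C^\infty(\mathbb R^d),\ \sum_{|\alpha|\le k}\sup_x|\partial_\alpha\phi(x)|\le 1\Big\}.$$ For $q,k,m\in\mathbb N$ with $m\ge1$, $\mu\in\mathcal M$ and a sequence $(\mu_n)_{n\ge0}$ in $\mathcal M_a$ let $$\pi_{q,k,m,e}(\mu,(\mu_n)_n)=\sum_{n=0}^\infty 2^{n(q+k)}\beta_e(2^{nd})\,d_k(\mu,\mu_n)+\sum_{n=0}^\infty\frac1{2^{2nm}}\|p_{\mu_n}\|_{2m+q,2m,(e)}\in[0,\infty],$$ let $\rho_{q,k,m,e}(\mu)$ be the infimum of $\pi_{q,k,m,e}(\mu,(\mu_n)_n)$ over all sequences $(\mu_n)_n$ in $\mathcal M_a$, and let $\mathcal S_{q,k,m,e}=\{\mu\in\mathcal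 M:\rho_{q,k,m,e}(\mu)<\infty\}$. **Theorem.** Let $q,k\in\mathbb N$, $m\in\mathbb N$ with $m\ge1$, and $e\in\mathcal E$. There is a finite constant $C$, depending only on $d,q,k,m,e$, such that every $\mu\in\mathcal S_{q,k,m,e}$ is absolutely continuous with respect to Lebesgue measure and its density satisfies $$p_\mu\in W^{q,e},\qquad \|p_\mu\|_{q,(e)}\le C\,\rho_{q,k,m,e}(\mu).$$ In particular, if $q=0$, then $p_\mu\in L^e$ and $\|p_\mu\|_{(e)}\le C\,\rho_{0,k,m,e}(\mu)$. -/

import Mathlib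

open MeasureTheory
open scoped ENNReal NNReal ContDiff

namespace OrliczCriterion

noncomputable section

/-- The class `𝓔` of Young functions satisfying the doubling condition. -/
structure YoungClass (e : ℝ → ℝ) : Prop where
  nonneg : ∀ s, 0 ≤ e s
  map_zero : e 0 = 0
  symm : ∀ s, e (-s) = e s
  strictConvex : StrictConvexOn ℝ Set.univ e
  doubling : ∃ lam : ℝ, 0 < lam ∧ ∀ s, e (2 * s) ≤ lam * e s
  monotone_div : MonotoneOn (fun s => e s / s) (Set.Ioi 0)

/-- `e⁻¹(a) = sup {c : e c ≤ a}`. -/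
def youngInv (e : ℝ → ℝ) (a : ℝ) : ℝ := sSup {c : ℝ | e c ≤ a}

/-- `β_e(R) = R / e⁻¹(R)`. -/
def youngBeta (e : ℝ → ℝ) (R : ℝ) : ℝ := R / youngInv e R

/-- The underlying space `ℝ^d` with the Euclidean norm. -/
abbrev Space (d : ℕ) : Type := EuclideanSpace ℝ (Fin d)

/-- The Luxemburg norm `inf {c > 0 : ∫ e(f(x)/c) dx ≤ 1}`, infinite if there is no such `c`. -/
def luxNorm {d : ℕ} (e : ℝ → ℝ) (f : Space d → ℝ) : ℝ≥0∞ :=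
  ⨅ (c : ℝ) (_ : 0 < c ∧ ∫⁻ x, ENNReal.ofReal (e (1 / c * f x)) ≤ 1), ENNReal.ofReal c

/-- The Orlicz space `L^e`. -/
def orliczSpace (d : ℕ) (e : ℝ → ℝ) : Set (Space d → ℝ) :=
  {f | AEStronglyMeasurable f volume ∧ luxNorm e f < ⊤}

/-- The multi-indices `α ∈ ℕ^d` with `|α| ≤ k`. -/
def multiIndices (d k : ℕ) : Finset (Fin d → ℕ) :=
  (Fintype.piFinset fun _ => Finset.range (k + 1)).filter fun α => ∑ i, α i ≤ k

theorem mem_multiIndices {d k : ℕ} {α : Fin d → ℕ} :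
    α ∈ multiIndices d k ↔ ∑ i, α i ≤ k := by
  simp only [multiIndices, Finset.mem_filter, Fintype.mem_piFinset, Finset.mem_range,
    and_iff_right_iff_imp]
  intro h i
  exact Nat.lt_succ_of_le
    ((Finset.single_le_sum (f := α) (fun j _ => Nat.zero_le (α j)) (Finset.mem_univ i)).trans h)

/-- The partial derivative `∂_i f`. -/
def partialDeriv {d : ℕ} (i : Fin d) (f : Space d → ℝ) : Space d → ℝ :=
  fun x => fderiv ℝ f x (EuclideanSpace.single i 1)

/-- The classical derivative `∂_α f = ∂_1^{α_1} ⋯ ∂_d^{α_d} f`; only used for smooth `f`. -/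
def multiDeriv {d : ℕ} (α : Fin d → ℕ) (f : Space d → ℝ) : Space d → ℝ :=
  (List.finRange d).foldr (fun i g => (partialDeriv i)^[α i] g) f

/-- `g` is the weak derivative `∂_α f`. -/
def HasWeakDeriv {d : ℕ} (α : Fin d → ℕ) (f g : Space d → ℝ) : Prop :=
  LocallyIntegrable f volume ∧ LocallyIntegrable g volume ∧
    ∀ φ : Space d → ℝ, ContDiff ℝ ∞ φ → HasCompactSupport φ →
      ∫ x, f x * multiDeriv α φ x = (-1) ^ (∑ i, α i) * ∫ x, g x * φ x

/-- `‖x^γ ∂_α f‖_(e)` for the weak derivative `∂_α f`; infinite if the latter does not exist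
(weak derivatives are unique almost everywhere, so the infimum is over one class). -/
def weightedDerivNorm {d : ℕ} (e : ℝ → ℝ) (γ α : Fin d → ℕ) (f : Space d → ℝ) : ℝ≥0∞ :=
  ⨅ (g : Space d → ℝ) (_ : HasWeakDeriv α f g), luxNorm e (fun x => (∏ i, x i ^ γ i) * g x)

/-- `‖f‖_{k,(e)} = ∑_{|α| ≤ k} ‖∂_α f‖_(e)`. -/
def sobolevNorm {d : ℕ} (e : ℝ → ℝ) (k : ℕ) (f : Space d → ℝ) : ℝ≥0∞ :=
  ∑ α ∈ multiIndices d k, weightedDerivNorm e 0 α f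

/-- The Sobolev–Orlicz space `W^{k,e}`. -/
def sobolevSpace (d : ℕ) (e : ℝ → ℝ) (k : ℕ) : Set (Space d → ℝ) :=
  {f | sobolevNorm e k f < ⊤}

/-- `‖f‖_{k,l,(e)} = ∑_{|γ| ≤ l} ∑_{|α| ≤ k} ‖x^γ ∂_α f‖_(e)`. -/
def weightedSobolevNorm {d : ℕ} (e : ℝ → ℝ) (k l : ℕ) (f : Space d → ℝ) : ℝ≥0∞ :=
  ∑ γ ∈ multiIndices d l, ∑ α ∈ multiIndices d k, weightedDerivNorm e γ α f

/-- `‖φ‖_{k,∞} = ∑_{|α| ≤ k} sup |∂_α φ|` for smooth `φ`. -/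
def supNorm {d : ℕ} (k : ℕ) (φ : Space d → ℝ) : ℝ≥0∞ :=
  ∑ α ∈ multiIndices d k, ⨆ x, ENNReal.ofReal |multiDeriv α φ x|

/-- The distance `d_k(μ, ν)` between finite signed Borel measures. -/
def measDist {d : ℕ} (k : ℕ) (μ ν : SignedMeasure (Space d)) : ℝ≥0∞ :=
  ⨆ (φ : Space d → ℝ) (_ : ContDiff ℝ ∞ φ ∧ supNorm k φ ≤ 1),
    ENNReal.ofReal |(∫ᵛ x, φ x ∂<•μ) - ∫ᵛ x, φ x ∂<•ν|

/-- `μ` is absolutely continuous with respect to the Lebesgue measure. -/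
def AbsCont {d : ℕ} (μ : SignedMeasure (Space d)) : Prop :=
  VectorMeasure.AbsolutelyContinuous μ (volume : Measure (Space d)).toENNRealVectorMeasure

/-- The density `p_μ` with respect to the Lebesgue measure. -/
def density {d : ℕ} (μ : SignedMeasure (Space d)) : Space d → ℝ :=
  μ.rnDeriv volume

/-- The density is characterized by `μ(dx) = p_μ(x) dx`. -/
theorem absCont_iff_withDensity {d : ℕ} (μ : SignedMeasure (Space d)) :
    AbsCont μ ↔ volume.withDensityᵥ (density μ) = μ :=
  SignedMeasure.absolutelyContinuous_iff_withDensityᵥ_rnDeriv_eq μ volume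

/-- The balance `π_{q,k,m,e}(μ, (μ_n)_n)`. -/
def balance {d : ℕ} (q k m : ℕ) (e : ℝ → ℝ) (μ : SignedMeasure (Space d))
    (ν : ℕ → SignedMeasure (Space d)) : ℝ≥0∞ :=
  (∑' n : ℕ, ENNReal.ofReal (2 ^ (n * (q + k)) * youngBeta e (2 ^ (n * d))) *
      measDist k μ (ν n)) +
    ∑' n : ℕ, ENNReal.ofReal (1 / 2 ^ (2 * n * m)) *
      weightedSobolevNorm e (2 * m + q) (2 * m) (density (ν n))

/-- `ρ_{q,k,m,e}(μ)`, the infimum of the balance over the sequences of absolutely continuous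
finite signed measures. -/
def rho {d : ℕ} (q k m : ℕ) (e : ℝ → ℝ) (μ : SignedMeasure (Space d)) : ℝ≥0∞ :=
  ⨅ (ν : ℕ → SignedMeasure (Space d)) (_ : ∀ n, AbsCont (ν n)), balance q k m e μ ν

/-- The class `𝓢_{q,k,m,e}`. -/
def approxClass (d q k m : ℕ) (e : ℝ → ℝ) : Set (SignedMeasure (Space d)) :=
  {μ | rho q k m e μ < ⊤}

end

end OrliczCriterion

open OrliczCriterion

/-!
# Regularity of measures that are well approximated by smooth densities

The measure `μ` is compared with its mollifications `K_n * μ`, where `K_n(x) = 2^{nd} K(2^n x)`. The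
kernel `K` (`exists_kernel`) is a tensor power of a kernel on the line whose moments of orders
`1, …, 2m` vanish, which makes the difference of two consecutive scales a sum of pure derivatives of
order `2m`, `K_1 - K_0 = ∑_i ∂_i^{2m} θ_i`, with smooth compactly supported `θ_i`.

For an absolutely continuous `ν_n` the increment `(K_{n+1} - K_n) * ∂_α μ` is split into the part
coming from `μ - ν_n` and the part coming from `ν_n`.

* The functions `∂_α K_j * (μ - ν_n)`, for `j = n` and `j = n + 1`, are bounded in `L^∞` by
  `M 2^{nd}` and, by duality, in `L¹` by `M`, where `M` is a multiple of `2^{n(q+k)} d_k(μ, ν_n)`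
  (`exists_moll_sub_bound`). Any function with these two bounds has Luxemburg norm at most
  `M β_e(2^{nd})` (`luxNorm_le_mul_youngBeta`).
* In `∂_α (K_{n+1} - K_n) * ν_n` the `2m` derivatives of the kernel are moved to the density of
  `ν_n`. This gains `2^{-2nm}` (`moll_increment_eq`), and convolution with an integrable kernel is
  bounded for the Luxemburg norm by Jensen's inequality (`luxNorm_conv_le`).

Hence the Luxemburg norms of the increments sum up to at most a constant times the balance
(`exists_tsum_luxNorm_increment_le`). Countable subadditivity of the norm shows that the increments
converge almost everywhere, dominated by a locally integrable function, and their sum represents the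
distribution `∂_α μ` (`exists_distribDeriv`). For `α = 0` this says that `μ` is absolutely
continuous (`absCont_of_integral_eq`); for the other `α` it identifies the weak derivatives of the
density. The increments do not depend on the approximating sequence, so the infimum over all
sequences can be taken at the end. Of the weighted norms in the balance only the terms without
weight are needed.
-/

namespace OrliczCriterion

/-! ### Young functions -/

namespace YoungClass

variable {e : ℝ → ℝ}

theorem continuous (he : YoungClass e) : Continuous e :=
  continuousOn_univ.1 (he.strictConvex.convexOn.continuousOn isOpen_univ)

theorem map_abs (he : YoungClass e) (s : ℝ) : e |s| = e s := by
  rcases abs_choice s with h | h <;> simp [h, he.symm]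

theorem map_mul_le (he : YoungClass e) {t : ℝ} (h0 : 0 ≤ t) (h1 : t ≤ 1) (s : ℝ) :
    e (t * s) ≤ t * e s := by
  have := he.strictConvex.convexOn.2 (Set.mem_univ s) (Set.mem_univ 0) h0 (sub_nonneg.2 h1)
    (by ring)
  simpa [he.map_zero] using this

theorem mono_abs (he : YoungClass e) {s t : ℝ} (h : |s| ≤ |t|) : e s ≤ e t := by
  rw [← he.map_abs s, ← he.map_abs t]
  rcases (abs_nonneg t).eq_or_lt with ht | ht
  · have : |s| = |t| := le_antisymm h (ht ▸ abs_nonneg s)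
    rw [this]
  · have h1 : |s| / |t| ≤ 1 := (div_le_one ht).2 h
    calc e |s| = e (|s| / |t| * |t|) := by rw [div_mul_cancel₀ _ ht.ne']
      _ ≤ |s| / |t| * e |t| := he.map_mul_le (by positivity) h1 _
      _ ≤ 1 * e |t| := by gcongr; exact he.nonneg _
      _ = e |t| := one_mul _

theorem mono (he : YoungClass e) {s t : ℝ} (h0 : 0 ≤ s) (h : s ≤ t) : e s ≤ e t :=
  he.mono_abs (by rwa [abs_of_nonneg h0, abs_of_nonneg (h0.trans h)])

theorem map_one_pos (he : YoungClass e) : 0 < e 1 := by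
  have h := he.strictConvex.2 (Set.mem_univ (1 : ℝ)) (Set.mem_univ (-1 : ℝ)) (by norm_num)
    (show (0 : ℝ) < 1 / 2 by norm_num) (show (0 : ℝ) < 1 / 2 by norm_num) (by norm_num)
  norm_num [he.map_zero, he.symm] at h
  exact h

theorem mul_map_one_le (he : YoungClass e) {s : ℝ} (hs : 1 ≤ s) : s * e 1 ≤ e s := by
  have h := he.map_mul_le (t := 1 / s) (by positivity) ((div_le_one (by positivity)).2 hs) s
  have hs0 : 0 < s := by positivity
  rw [one_div_mul_cancel hs0.ne', one_div, inv_mul_eq_div, le_div_iff₀ hs0] at h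
  linarith

theorem abs_le_one_add (he : YoungClass e) (s : ℝ) : |s| ≤ 1 + e s / e 1 := by
  have h1 := he.map_one_pos
  rcases le_total |s| 1 with h | h
  · have := div_nonneg (he.nonneg s) h1.le
    linarith
  · have := he.mul_map_one_le h
    rw [he.map_abs, ← le_div_iff₀ h1] at this
    linarith

theorem bddAbove_sublevel (he : YoungClass e) (a : ℝ) : BddAbove {c : ℝ | e c ≤ a} := by
  refine ⟨1 + a / e 1, fun c hc => ?_⟩
  have h1 := he.map_one_pos
  calc c ≤ |c| := le_abs_self c
    _ ≤ 1 + e c / e 1 := he.abs_le_one_add c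
    _ ≤ 1 + a / e 1 := by gcongr; exact hc

theorem map_youngInv_le (he : YoungClass e) {a : ℝ} (ha : 0 ≤ a) : e (youngInv e a) ≤ a := by
  have hcl : IsClosed {c : ℝ | e c ≤ a} := isClosed_le he.continuous continuous_const
  exact hcl.csSup_mem ⟨0, by simpa [he.map_zero] using ha⟩ (he.bddAbove_sublevel a)

theorem youngInv_pos (he : YoungClass e) {a : ℝ} (ha : 0 < a) : 0 < youngInv e a := by
  have h1 := he.map_one_pos
  have hpos : 0 < min 1 (a / e 1) := lt_min one_pos (div_pos ha h1)
  refine hpos.trans_le (le_csSup (he.bddAbove_sublevel a) ?_)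
  have := he.map_mul_le hpos.le (min_le_left _ _) 1
  rw [mul_one] at this
  refine this.trans ?_
  calc min 1 (a / e 1) * e 1 ≤ a / e 1 * e 1 := by gcongr; exact min_le_right _ _
    _ = a := div_mul_cancel₀ _ h1.ne'

theorem youngBeta_pos (he : YoungClass e) {a : ℝ} (ha : 0 < a) : 0 < youngBeta e a :=
  div_pos ha (he.youngInv_pos ha)

/-- Jensen's inequality in the form behind the triangle inequality for the Luxemburg norm. -/
theorem map_div_le_sum (he : YoungClass e) {ι : Type*} (s : Finset ι) {c : ι → ℝ}
    (hc : ∀ i, 0 < c i) {C : ℝ} (hC : 0 < C) (hsum : ∑ i ∈ s, c i ≤ C) {h : ι → ℝ} {t : ℝ}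
    (ht : |t| ≤ ∑ i ∈ s, |h i|) :
    e (1 / C * t) ≤ ∑ i ∈ s, c i / C * e (1 / c i * h i) := by
  rcases s.eq_empty_or_nonempty with rfl | hs
  · have : t = 0 := by simpa using ht
    simp [this, he.map_zero]
  have hS : 0 < ∑ i ∈ s, c i := Finset.sum_pos (fun i _ => hc i) hs
  set S := ∑ i ∈ s, c i
  have hJ := he.strictConvex.convexOn.map_sum_le (t := s) (w := fun i => c i / S)
    (p := fun i => 1 / c i * |h i|) (fun i _ => (div_pos (hc i) hS).le)
    (by rw [← Finset.sum_div, div_self hS.ne']) (fun _ _ => Set.mem_univ _)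
  simp only [smul_eq_mul] at hJ
  have hpt : ∑ i ∈ s, c i / S * (1 / c i * |h i|) = (∑ i ∈ s, |h i|) / S := by
    rw [Finset.sum_div]
    refine Finset.sum_congr rfl fun i _ => ?_
    have := (hc i).ne'
    field_simp
  have hpt' : ∀ i, e (1 / c i * |h i|) = e (1 / c i * h i) := fun i => by
    rw [← he.map_abs (1 / c i * h i), abs_mul, abs_of_pos (one_div_pos.2 (hc i))]
  rw [hpt] at hJ
  simp only [hpt'] at hJ
  calc e (1 / C * t) = e (S / C * (t / S)) := by congr 1; field_simp
    _ ≤ S / C * e (t / S) := he.map_mul_le (by positivity) ((div_le_one hC).2 hsum) _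
    _ ≤ S / C * e ((∑ i ∈ s, |h i|) / S) := by
      gcongr
      apply he.mono_abs
      rw [abs_div, abs_div, abs_of_nonneg (Finset.sum_nonneg fun i _ => abs_nonneg (h i))]
      gcongr
    _ ≤ S / C * ∑ i ∈ s, c i / S * e (1 / c i * h i) := by gcongr
    _ = ∑ i ∈ s, c i / C * e (1 / c i * h i) := by
      rw [Finset.mul_sum]
      refine Finset.sum_congr rfl fun i _ => ?_
      field_simp

/-- The strict hypothesis lets a finite partial sum dominate `|t|`, also where the series
diverges. -/
theorem map_div_le_tsum_of_lt (he : YoungClass e) {ι : Type*} {c : ι → ℝ}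
    (hc : ∀ i, 0 < c i) {C : ℝ} (hC : 0 < C) (hsum : ∑' i, ENNReal.ofReal (c i) ≤ ENNReal.ofReal C)
    {h : ι → ℝ} {t : ℝ} (ht : ENNReal.ofReal |t| < ∑' i, ENNReal.ofReal |h i|) :
    ENNReal.ofReal (e (1 / C * t)) ≤
      ∑' i, ENNReal.ofReal (c i / C) * ENNReal.ofReal (e (1 / c i * h i)) := by
  rw [ENNReal.tsum_eq_iSup_sum, lt_iSup_iff] at ht
  obtain ⟨s, hs⟩ := ht
  rw [← ENNReal.ofReal_sum_of_nonneg fun i _ => abs_nonneg _] at hs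
  have hs' := (ENNReal.ofReal_le_ofReal_iff (Finset.sum_nonneg fun i _ => abs_nonneg (h i))).1 hs.le
  have hcs : ∑ i ∈ s, c i ≤ C := by
    have := (ENNReal.sum_le_tsum s).trans hsum
    rwa [← ENNReal.ofReal_sum_of_nonneg fun i _ => (hc i).le,
      ENNReal.ofReal_le_ofReal_iff hC.le] at this
  refine le_trans ?_ (ENNReal.sum_le_tsum s)
  refine (ENNReal.ofReal_le_ofReal (he.map_div_le_sum s hc hC hcs hs')).trans ?_
  rw [ENNReal.ofReal_sum_of_nonneg fun i _ =>
    mul_nonneg (div_pos (hc i) hC).le (he.nonneg _)]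
  refine Finset.sum_le_sum fun i _ => ?_
  rw [ENNReal.ofReal_mul (div_pos (hc i) hC).le]

/-- Equality in the hypothesis is allowed because `e` is continuous: shrink `t` slightly. -/
theorem map_div_le_tsum (he : YoungClass e) {ι : Type*} {c : ι → ℝ}
    (hc : ∀ i, 0 < c i) {C : ℝ} (hC : 0 < C) (hsum : ∑' i, ENNReal.ofReal (c i) ≤ ENNReal.ofReal C)
    {h : ι → ℝ} {t : ℝ} (ht : ENNReal.ofReal |t| ≤ ∑' i, ENNReal.ofReal |h i|) :
    ENNReal.ofReal (e (1 / C * t)) ≤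
      ∑' i, ENNReal.ofReal (c i / C) * ENNReal.ofReal (e (1 / c i * h i)) := by
  rcases eq_or_ne t 0 with rfl | h0
  · simp [he.map_zero]
  have hcont : Continuous fun r : ℝ => ENNReal.ofReal (e (1 / C * (r * t))) :=
    ENNReal.continuous_ofReal.comp (he.continuous.comp (by fun_prop))
  have hlim : Filter.Tendsto (fun r : ℝ => ENNReal.ofReal (e (1 / C * (r * t))))
      (nhdsWithin 1 (Set.Iio 1)) (nhds (ENNReal.ofReal (e (1 / C * t)))) := by
    have := (hcont.tendsto 1).mono_left (nhdsWithin_le_nhds (s := Set.Iio 1))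
    simpa using this
  refine le_of_tendsto hlim ?_
  filter_upwards [self_mem_nhdsWithin, nhdsWithin_le_nhds (Ioi_mem_nhds (zero_lt_one' ℝ))]
    with r hr1 hr0
  refine he.map_div_le_tsum_of_lt hc hC hsum (lt_of_lt_of_le ?_ ht)
  rw [ENNReal.ofReal_lt_ofReal_iff (abs_pos.2 h0), abs_mul, abs_of_pos (by simpa using hr0)]
  have := abs_pos.2 h0
  have : r < 1 := hr1
  nlinarith

end YoungClass

/-! ### The Luxemburg norm -/

section Lux

variable {d : ℕ} {e : ℝ → ℝ}

theorem luxNorm_le_ofReal {f : Space d → ℝ} {c : ℝ} (hc : 0 < c)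
    (h : ∫⁻ x, ENNReal.ofReal (e (1 / c * f x)) ≤ 1) : luxNorm e f ≤ ENNReal.ofReal c :=
  iInf₂_le c ⟨hc, h⟩

theorem lintegral_le_one_of_luxNorm_lt (he : YoungClass e) {f : Space d → ℝ} {c : ℝ}
    (h : luxNorm e f < ENNReal.ofReal c) :
    0 < c ∧ ∫⁻ x, ENNReal.ofReal (e (1 / c * f x)) ≤ 1 := by
  simp only [luxNorm, iInf_lt_iff] at h
  obtain ⟨b, ⟨hb, hb1⟩, hbc⟩ := h
  have hbc' : b < c := (ENNReal.ofReal_lt_ofReal_iff_of_nonneg hb.le).1 hbc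
  refine ⟨hb.trans hbc', le_trans (lintegral_mono fun x => ?_) hb1⟩
  refine ENNReal.ofReal_le_ofReal (he.mono_abs ?_)
  rw [abs_mul, abs_mul, abs_of_pos (one_div_pos.2 hb), abs_of_pos (one_div_pos.2 (hb.trans hbc'))]
  gcongr

theorem luxNorm_le_of_forall_lt {f : Space d → ℝ} {A : ℝ≥0∞}
    (h : ∀ c : ℝ, A < ENNReal.ofReal c → luxNorm e f ≤ ENNReal.ofReal c) : luxNorm e f ≤ A := by
  refine le_of_forall_gt_imp_ge_of_dense fun a ha => ?_
  rcases eq_or_ne a ⊤ with rfl | hne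
  · exact le_top
  · rw [← ENNReal.ofReal_toReal hne] at ha ⊢
    exact h _ ha

/-- A series of Luxemburg norms below `C` admits scales `c_i`, one for each function, that are
admissible in the definition of the norm and still sum up to at most `C`. -/
theorem exists_scales (he : YoungClass e) {ι : Type*} [Countable ι] {h : ι → Space d → ℝ} {C : ℝ}
    (hC : ∑' i, luxNorm e (h i) < ENNReal.ofReal C) :
    ∃ c : ι → ℝ, (∀ i, 0 < c i) ∧ ∑' i, ENNReal.ofReal (c i) ≤ ENNReal.ofReal C ∧
      ∀ i, ∫⁻ x, ENNReal.ofReal (e (1 / c i * h i x)) ≤ 1 := by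
  obtain ⟨ε, hε, hεC⟩ := ENNReal.exists_pos_sum_of_countable' (tsub_pos_of_lt hC).ne' ι
  have hfin : ∀ i, luxNorm e (h i) ≠ ⊤ := fun i =>
    ((ENNReal.le_tsum i).trans_lt (hC.trans ENNReal.ofReal_lt_top)).ne
  have hεfin : ∀ i, ε i ≠ ⊤ := fun i =>
    ((ENNReal.le_tsum i).trans_lt (hεC.trans_le (tsub_le_self.trans le_top))).ne_top
  have hne : ∀ i, luxNorm e (h i) + ε i ≠ ⊤ := fun i => ENNReal.add_ne_top.2 ⟨hfin i, hεfin i⟩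
  have key : ∀ i, 0 < (luxNorm e (h i) + ε i).toReal ∧
      ∫⁻ x, ENNReal.ofReal (e (1 / (luxNorm e (h i) + ε i).toReal * h i x)) ≤ 1 := fun i => by
    refine lintegral_le_one_of_luxNorm_lt he ?_
    rw [ENNReal.ofReal_toReal (hne i)]
    exact ENNReal.lt_add_right (hfin i) (hε i).ne'
  refine ⟨fun i => (luxNorm e (h i) + ε i).toReal, fun i => (key i).1, ?_, fun i => (key i).2⟩
  simp only [ENNReal.ofReal_toReal (hne _)]
  rw [ENNReal.tsum_add]
  calc _ ≤ ∑' i, luxNorm e (h i) + (ENNReal.ofReal C - ∑' i, luxNorm e (h i)) := by gcongr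
    _ = _ := add_tsub_cancel_of_le hC.le

theorem lintegral_tsum_scales_le_one (he : YoungClass e) {ι : Type*} [Countable ι]
    {h : ι → Space d → ℝ} (hm : ∀ i, AEStronglyMeasurable (h i) volume) {C : ℝ} (hC0 : 0 < C)
    {c : ι → ℝ} (hcC : ∑' i, ENNReal.ofReal (c i) ≤ ENNReal.ofReal C)
    (hint : ∀ i, ∫⁻ x, ENNReal.ofReal (e (1 / c i * h i x)) ≤ 1) :
    ∫⁻ x, ∑' i, ENNReal.ofReal (c i / C) * ENNReal.ofReal (e (1 / c i * h i x)) ≤ 1 := by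
  have hmeas : ∀ i, AEMeasurable (fun x => ENNReal.ofReal (e (1 / c i * h i x))) volume :=
    fun i => (he.continuous.measurable.comp_aemeasurable
      ((hm i).aemeasurable.const_mul _)).ennreal_ofReal
  rw [lintegral_tsum fun i => (hmeas i).const_mul _]
  simp only [lintegral_const_mul'' _ (hmeas _)]
  calc ∑' i, ENNReal.ofReal (c i / C) * ∫⁻ x, ENNReal.ofReal (e (1 / c i * h i x))
      ≤ ∑' i, ENNReal.ofReal (c i / C) * 1 := by gcongr with i; exact hint i
    _ = (∑' i, ENNReal.ofReal (c i)) / ENNReal.ofReal C := by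
      simp only [mul_one, ENNReal.ofReal_div_of_pos hC0]
      simp only [div_eq_mul_inv, ENNReal.tsum_mul_right]
    _ ≤ 1 := ENNReal.div_le_of_le_mul (by simpa using hcC)

/-- Countable subadditivity of the Luxemburg norm. -/
theorem luxNorm_le_tsum (he : YoungClass e) {ι : Type*} [Countable ι] {h : ι → Space d → ℝ}
    {f : Space d → ℝ} (hm : ∀ i, AEStronglyMeasurable (h i) volume)
    (hf : ∀ᵐ x, ENNReal.ofReal |f x| ≤ ∑' i, ENNReal.ofReal |h i x|) :
    luxNorm e f ≤ ∑' i, luxNorm e (h i) := by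
  refine luxNorm_le_of_forall_lt fun C hC => ?_
  have hC0 : 0 < C := ENNReal.ofReal_pos.1 (bot_le.trans_lt hC)
  obtain ⟨c, hc, hcC, hint⟩ := exists_scales he hC
  refine luxNorm_le_ofReal hC0 (le_trans (lintegral_mono_ae ?_)
    (lintegral_tsum_scales_le_one he hm hC0 hcC hint))
  filter_upwards [hf] with x hx
  exact he.map_div_le_tsum hc hC0 hcC hx

theorem luxNorm_mono (he : YoungClass e) {f g : Space d → ℝ} (h : ∀ᵐ x, |f x| ≤ |g x|) :
    luxNorm e f ≤ luxNorm e g := by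
  refine luxNorm_le_of_forall_lt fun C hC => ?_
  obtain ⟨hC0, hint⟩ := lintegral_le_one_of_luxNorm_lt he hC
  refine luxNorm_le_ofReal hC0 (le_trans (lintegral_mono_ae ?_) hint)
  filter_upwards [h] with x hx
  refine ENNReal.ofReal_le_ofReal (he.mono_abs ?_)
  rw [abs_mul, abs_mul]
  gcongr

theorem luxNorm_congr (he : YoungClass e) {f g : Space d → ℝ} (h : f =ᵐ[volume] g) :
    luxNorm e f = luxNorm e g :=
  le_antisymm (luxNorm_mono he (h.mono fun x hx => by rw [hx]))
    (luxNorm_mono he (h.mono fun x hx => by rw [hx]))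

theorem luxNorm_add_le (he : YoungClass e) {f g k : Space d → ℝ}
    (hg : AEStronglyMeasurable g volume) (hk : AEStronglyMeasurable k volume)
    (h : ∀ x, |f x| ≤ |g x| + |k x|) : luxNorm e f ≤ luxNorm e g + luxNorm e k := by
  have := luxNorm_le_tsum he (h := fun b : Bool => if b then g else k) (f := f)
    (by rintro (_ | _) <;> simpa)
    (.of_forall fun x => by
      rw [tsum_fintype, Fintype.sum_bool]
      simp only [if_true, Bool.false_eq_true, if_false]
      rw [← ENNReal.ofReal_add (abs_nonneg _) (abs_nonneg _)]
      exact ENNReal.ofReal_le_ofReal (h x))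
  rw [tsum_fintype, Fintype.sum_bool] at this
  simpa using this

theorem luxNorm_sum_le (he : YoungClass e) {ι : Type*} [Fintype ι] {h : ι → Space d → ℝ}
    {f : Space d → ℝ} (hm : ∀ i, AEStronglyMeasurable (h i) volume)
    (hf : ∀ x, |f x| ≤ ∑ i, |h i x|) : luxNorm e f ≤ ∑ i, luxNorm e (h i) := by
  have := luxNorm_le_tsum he (h := h) (f := f) hm (.of_forall fun x => by
      rw [tsum_fintype, ← ENNReal.ofReal_sum_of_nonneg fun i _ => abs_nonneg _]
      exact ENNReal.ofReal_le_ofReal (hf x))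
  rwa [tsum_fintype] at this

theorem luxNorm_zero (he : YoungClass e) : luxNorm e (fun _ : Space d => 0) = 0 := by
  refine le_antisymm (luxNorm_le_of_forall_lt fun c hc => ?_) bot_le
  exact luxNorm_le_ofReal (ENNReal.ofReal_pos.1 (bot_le.trans_lt hc)) (by simp [he.map_zero])

theorem luxNorm_const_mul_le (he : YoungClass e) {a : ℝ} (ha : 0 ≤ a) (f : Space d → ℝ) :
    luxNorm e (fun x => a * f x) ≤ ENNReal.ofReal a * luxNorm e f := by
  rcases ha.eq_or_lt with rfl | ha
  · simp [luxNorm_zero he]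
  conv_rhs => rw [luxNorm]
  rw [ENNReal.mul_iInf_of_ne (by simpa using ha) ENNReal.ofReal_ne_top]
  refine le_iInf fun c => ?_
  by_cases hc : 0 < c ∧ ∫⁻ x, ENNReal.ofReal (e (1 / c * f x)) ≤ 1
  · rw [iInf_pos hc, ← ENNReal.ofReal_mul ha.le]
    refine luxNorm_le_ofReal (mul_pos ha hc.1) ?_
    have hfun : ∀ x, 1 / (a * c) * (a * f x) = 1 / c * f x := fun x => by
      have := hc.1
      field_simp
    simpa only [hfun] using hc.2
  · rw [iInf_neg hc]
    simp [ENNReal.mul_top, ha]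

/-- Interpolation between `L¹` and `L^∞`: the Luxemburg norm of a function with
`‖h‖₁ ≤ M` and `‖h‖_∞ ≤ M R` is at most `M β_e(R)`. -/
theorem luxNorm_le_mul_youngBeta (he : YoungClass e) {h : Space d → ℝ} {M R : ℝ}
    (hm : AEStronglyMeasurable h volume)
    (hM : 0 ≤ M) (hR : 0 < R) (hsup : ∀ x, |h x| ≤ M * R)
    (hint : ∫⁻ x, ENNReal.ofReal |h x| ≤ ENNReal.ofReal M) :
    luxNorm e h ≤ ENNReal.ofReal (M * youngBeta e R) := by
  rcases hM.eq_or_lt with rfl | hM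
  · have : h = fun _ => 0 := funext fun x => by simpa using hsup x
    rw [this, luxNorm_zero he]
    exact bot_le
  have hβ := he.youngBeta_pos hR
  have hI := he.youngInv_pos hR
  refine luxNorm_le_ofReal (mul_pos hM hβ) ?_
  have hpt : ∀ x, e (1 / (M * youngBeta e R) * h x) ≤ 1 / M * |h x| := fun x => by
    have h1 : 1 / (M * youngBeta e R) * |h x| = |h x| / (M * R) * youngInv e R := by
      rw [youngBeta]; field_simp
    rw [← he.map_abs, abs_mul, abs_of_pos (by positivity), h1]
    refine (he.map_mul_le (by positivity)
      ((div_le_one (by positivity)).2 (hsup x)) _).trans ?_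
    calc |h x| / (M * R) * e (youngInv e R) ≤ |h x| / (M * R) * R := by
          gcongr; exact he.map_youngInv_le hR.le
      _ = 1 / M * |h x| := by field_simp
  calc ∫⁻ x, ENNReal.ofReal (e (1 / (M * youngBeta e R) * h x))
      ≤ ∫⁻ x, ENNReal.ofReal (1 / M) * ENNReal.ofReal |h x| :=
        lintegral_mono fun x => by
          rw [← ENNReal.ofReal_mul (by positivity)]
          exact ENNReal.ofReal_le_ofReal (hpt x)
    _ = ENNReal.ofReal (1 / M) * ∫⁻ x, ENNReal.ofReal |h x| :=
        lintegral_const_mul'' _ (by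
          exact (continuous_abs.measurable.comp_aemeasurable hm.aemeasurable).ennreal_ofReal)
    _ ≤ ENNReal.ofReal (1 / M) * ENNReal.ofReal M := by gcongr
    _ = 1 := by rw [← ENNReal.ofReal_mul (by positivity)]; field_simp; simp

theorem integrable_map_of_lintegral_le_one (he : YoungClass e) {f : Space d → ℝ}
    (hm : AEStronglyMeasurable f volume) {c : ℝ}
    (h : ∫⁻ x, ENNReal.ofReal (e (1 / c * f x)) ≤ 1) :
    Integrable (fun x => e (1 / c * f x)) volume := by
  refine (lintegral_ofReal_ne_top_iff_integrable
    (he.continuous.comp_aestronglyMeasurable (hm.const_mul _))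
    (.of_forall fun x => he.nonneg _)).1 (h.trans_lt ENNReal.one_lt_top).ne

/-- An Orlicz function is locally integrable since a Young function grows at least linearly. -/
theorem locallyIntegrable_of_luxNorm_lt_top (he : YoungClass e) {f : Space d → ℝ}
    (hm : AEStronglyMeasurable f volume) (h : luxNorm e f < ⊤) : LocallyIntegrable f volume := by
  obtain ⟨c, -, hc⟩ := ENNReal.lt_iff_exists_real_btwn.1 h
  obtain ⟨hc0, hint⟩ := lintegral_le_one_of_luxNorm_lt he hc.1
  have hI := integrable_map_of_lintegral_le_one he hm hint
  have hloc : LocallyIntegrable (fun x => c * (1 + e (1 / c * f x) / e 1)) volume :=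
    (((continuous_const (y := (1 : ℝ))).locallyIntegrable.add
      (hI.div_const _).locallyIntegrable)).smul c
  refine hloc.mono hm (.of_forall fun x => ?_)
  have h1 := he.abs_le_one_add (1 / c * f x)
  rw [abs_mul, abs_of_pos (one_div_pos.2 hc0), one_div_mul_eq_div, div_le_iff₀' hc0] at h1
  rw [Real.norm_eq_abs]
  exact h1.trans (le_abs_self _)

theorem ae_summable_of_tsum_luxNorm_lt_top (he : YoungClass e) {h : ℕ → Space d → ℝ}
    (hm : ∀ i, AEStronglyMeasurable (h i) volume) (hfin : ∑' i, luxNorm e (h i) < ⊤) :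
    ∀ᵐ x, Summable fun i => |h i x| := by
  obtain ⟨C, -, hC, -⟩ := ENNReal.lt_iff_exists_real_btwn.1 hfin
  have hC0 : 0 < C := ENNReal.ofReal_pos.1 (bot_le.trans_lt hC)
  obtain ⟨c, hc, hcC, hint⟩ := exists_scales he hC
  have hle := lintegral_tsum_scales_le_one he hm hC0 hcC hint
  have hmeas : ∀ i, AEMeasurable (fun x => ENNReal.ofReal (c i / C) *
      ENNReal.ofReal (e (1 / c i * h i x))) volume :=
    fun i => ((he.continuous.measurable.comp_aemeasurable
      ((hm i).aemeasurable.const_mul _)).ennreal_ofReal).const_mul _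
  filter_upwards [ae_lt_top' (AEMeasurable.tsum hmeas) (hle.trans_lt ENNReal.one_lt_top).ne]
    with x hx
  by_contra hns
  have htop : ∑' i, ENNReal.ofReal |h i x| = ⊤ := by
    by_contra hne
    refine hns ?_
    have := ENNReal.summable_toReal hne
    simpa only [ENNReal.toReal_ofReal (abs_nonneg _)] using this
  set Φ := ∑' i, ENNReal.ofReal (c i / C) * ENNReal.ofReal (e (1 / c i * h i x))
  -- a Young function grows at least linearly, so it exceeds the finite value `Φ` at some point
  set s : ℝ := 1 + (Φ.toReal + 1) / e 1
  have hs : 1 ≤ s := by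
    have := he.map_one_pos
    have := ENNReal.toReal_nonneg (a := Φ)
    simp only [s, le_add_iff_nonneg_right]
    positivity
  have h1 : Φ.toReal + 1 ≤ e s := by
    have h2 := he.mul_map_one_le hs
    have h3 := he.map_one_pos
    have : s * e 1 = e 1 + (Φ.toReal + 1) := by simp only [s]; field_simp
    linarith
  have h4 := he.map_div_le_tsum_of_lt hc hC0 hcC (h := fun i => h i x) (t := C * s)
    (by rw [htop]; exact ENNReal.ofReal_lt_top)
  rw [one_div, inv_mul_cancel_left₀ hC0.ne'] at h4
  have h5 := (ENNReal.ofReal_le_iff_le_toReal hx.ne).1 h4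
  linarith

/-- Young's inequality for convolutions: if `|h| ≤ |θ| * |g|` then
`‖h‖_(e) ≤ ‖θ‖₁ ‖g‖_(e)`. -/
theorem luxNorm_conv_le (he : YoungClass e) {θ g h : Space d → ℝ} (hθ : Continuous θ)
    (hθc : HasCompactSupport θ) (hg : LocallyIntegrable g volume)
    (hh : ∀ x, |h x| ≤ ∫ y, |θ (x - y)| * |g y|) :
    luxNorm e h ≤ ENNReal.ofReal (∫ y, |θ y|) * luxNorm e g := by
  have hθi : Integrable (fun y => |θ y|) volume := (hθ.integrable_of_hasCompactSupport hθc).abs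
  set T := ∫ y, |θ y| with hT
  have hT0 : 0 ≤ T := integral_nonneg fun y => abs_nonneg _
  have hshift : ∀ x, ∫ y, |θ (x - y)| = T := fun x => integral_sub_left_eq_self (fun y => |θ y|) _ x
  rcases hT0.eq_or_lt with hT0 | hT0
  · -- a continuous kernel of zero mass vanishes
    have hz : θ = 0 := by
      have h1 : (fun y => |θ y|) =ᵐ[volume] 0 :=
        (integral_eq_zero_iff_of_nonneg (fun y => abs_nonneg _) hθi).1 (by rw [← hT, ← hT0])
      have h2 := (Continuous.ae_eq_iff_eq volume hθ.abs continuous_zero).1 h1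
      funext y
      simpa using congrFun h2 y
    have : h = fun _ => 0 := funext fun x => by simpa [hz] using hh x
    rw [this, luxNorm_zero he]
    exact bot_le
  refine luxNorm_le_of_forall_lt fun C hC => ?_
  have hTne : ENNReal.ofReal T ≠ 0 := by simpa using hT0
  have hC0 : 0 < C := ENNReal.ofReal_pos.1 (bot_le.trans_lt hC)
  have hC' : luxNorm e g < ENNReal.ofReal (C / T) := by
    rw [ENNReal.ofReal_div_of_pos hT0, ENNReal.lt_div_iff_mul_lt (by simp [hT0]) (by simp)]
    rwa [mul_comm]
  obtain ⟨hc0, hint⟩ := lintegral_le_one_of_luxNorm_lt he hC'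
  set c := C / T with hcdef
  have hgi := integrable_map_of_lintegral_le_one he hg.aestronglyMeasurable hint
  have hcont : ∀ x, Continuous fun y => |θ (x - y)| := fun x =>
    (hθ.comp (continuous_const.sub continuous_id)).abs
  have hcs : ∀ x, HasCompactSupport fun y => |θ (x - y)| := fun x =>
    (hθc.comp_homeomorph (Homeomorph.subLeft x)).comp_left (g := fun t : ℝ => |t|) abs_zero
  obtain ⟨B, hB⟩ := hθ.bounded_above_of_compact_support hθc
  -- Jensen's inequality for the probability density `|θ (x - ·)| / ‖θ‖₁`
  have hpt : ∀ x, e (1 / C * h x) ≤ T⁻¹ * ∫ y, |θ (x - y)| * e (1 / c * g y) := fun x => by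
    let π : Measure (Space d) := volume.withDensity fun y => ENNReal.ofReal (T⁻¹ * |θ (x - y)|)
    have hdm : Measurable fun y => T⁻¹ * |θ (x - y)| := ((hcont x).const_mul _).measurable
    have hd0 : ∀ y, 0 ≤ T⁻¹ * |θ (x - y)| := fun y => by positivity
    have hπ : IsProbabilityMeasure π := by
      constructor
      rw [withDensity_apply _ MeasurableSet.univ, Measure.restrict_univ,
        ← ofReal_integral_eq_lintegral_ofReal]
      · rw [integral_const_mul, hshift, inv_mul_cancel₀ hT0.ne', ENNReal.ofReal_one]
      · exact (((hcont x).integrable_of_hasCompactSupport (hcs x)).const_mul _)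
      · exact .of_forall hd0
    have hInt : ∀ u : Space d → ℝ, ∫ y, u y ∂π = T⁻¹ * ∫ y, |θ (x - y)| * u y := fun u => by
      rw [integral_withDensity_eq_integral_toReal_smul hdm.ennreal_ofReal
        (.of_forall fun _ => ENNReal.ofReal_lt_top), ← integral_const_mul]
      refine integral_congr_ae (.of_forall fun y => ?_)
      simp only [ENNReal.toReal_ofReal (hd0 y), smul_eq_mul, mul_assoc]
    have hIble : ∀ u : Space d → ℝ, Integrable (fun y => |θ (x - y)| * u y) volume →
        Integrable u π := fun u hu => by
      rw [integrable_withDensity_iff_integrable_smul' hdm.ennreal_ofReal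
        (.of_forall fun _ => ENNReal.ofReal_lt_top)]
      refine (hu.const_mul T⁻¹).congr (.of_forall fun y => ?_)
      simp only [ENNReal.toReal_ofReal (hd0 y), smul_eq_mul, mul_assoc]
    have hg1 : Integrable (fun y => |θ (x - y)| * |1 / c * g y|) volume := by
      have : LocallyIntegrable (fun y => |1 / c * g y|) volume :=
        (hg.smul (1 / c)).mono (hg.aestronglyMeasurable.const_mul _).norm
          (.of_forall fun y => by simp)
      exact this.integrable_smul_left_of_hasCompactSupport (hcont x) (hcs x)
    have hg2 : Integrable (fun y => |θ (x - y)| * e (1 / c * g y)) volume :=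
      hgi.bdd_mul (hcont x).aestronglyMeasurable
        (.of_forall fun y => by simpa using hB (x - y))
    have hJ := he.strictConvex.convexOn.map_integral_le (μ := π)
      he.continuous.continuousOn isClosed_univ
      (f := fun y => |1 / c * g y|) (.of_forall fun _ => Set.mem_univ _) (hIble _ hg1)
      (hIble _ (by simpa only [Function.comp_def, he.map_abs] using hg2))
    simp only [hInt, he.map_abs] at hJ
    refine le_trans (he.mono_abs ?_) hJ
    refine le_trans ?_ (le_abs_self _)
    rw [abs_mul, abs_of_pos (one_div_pos.2 hC0)]
    calc 1 / C * |h x| ≤ 1 / C * ∫ y, |θ (x - y)| * |g y| := by gcongr; exact hh x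
      _ = T⁻¹ * ∫ y, |θ (x - y)| * |1 / c * g y| := by
        rw [← integral_const_mul, ← integral_const_mul]
        refine integral_congr_ae (.of_forall fun y => ?_)
        have hTc : 1 / c = T⁻¹⁻¹ * (1 / C) := by rw [hcdef]; field_simp
        simp only [abs_mul, abs_of_pos (one_div_pos.2 hc0)]
        rw [hTc]
        field_simp
  refine luxNorm_le_ofReal hC0 ?_
  have hm2 : AEMeasurable (fun y => ENNReal.ofReal (e (1 / c * g y))) volume :=
    hgi.aestronglyMeasurable.aemeasurable.ennreal_ofReal
  calc ∫⁻ x, ENNReal.ofReal (e (1 / C * h x))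
      ≤ ∫⁻ x, ENNReal.ofReal T⁻¹ * ∫⁻ y, ENNReal.ofReal |θ (x - y)| *
          ENNReal.ofReal (e (1 / c * g y)) := by
        refine lintegral_mono fun x => ?_
        refine (ENNReal.ofReal_le_ofReal (hpt x)).trans ?_
        rw [ENNReal.ofReal_mul (by positivity)]
        gcongr
        simp only [← ENNReal.ofReal_mul (abs_nonneg _)]
        rw [ofReal_integral_eq_lintegral_ofReal]
        · exact hgi.bdd_mul (hcont x).aestronglyMeasurable
            (.of_forall fun y => by simpa using hB (x - y))
        · exact .of_forall fun y => mul_nonneg (abs_nonneg _) (he.nonneg _)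
    _ = ENNReal.ofReal T⁻¹ * ∫⁻ y, ∫⁻ x, ENNReal.ofReal |θ (x - y)| *
          ENNReal.ofReal (e (1 / c * g y)) := by
        rw [lintegral_const_mul' _ _ ENNReal.ofReal_ne_top, lintegral_lintegral_swap]
        refine AEMeasurable.mul ?_ hm2.comp_snd
        exact (hθ.comp
          (continuous_fst.sub continuous_snd)).abs.measurable.ennreal_ofReal.aemeasurable
    _ = ENNReal.ofReal T⁻¹ * ∫⁻ y, ENNReal.ofReal T * ENNReal.ofReal (e (1 / c * g y)) := by
        congr 1
        refine lintegral_congr fun y => ?_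
        rw [lintegral_mul_const' _ _ ENNReal.ofReal_ne_top,
          lintegral_sub_right_eq_self (fun x => ENNReal.ofReal |θ x|) y,
          ← ofReal_integral_eq_lintegral_ofReal hθi (.of_forall fun _ => abs_nonneg _)]
    _ = ENNReal.ofReal T⁻¹ * ENNReal.ofReal T * ∫⁻ y, ENNReal.ofReal (e (1 / c * g y)) := by
        rw [lintegral_const_mul' _ _ ENNReal.ofReal_ne_top, mul_assoc]
    _ ≤ ENNReal.ofReal T⁻¹ * ENNReal.ofReal T * 1 := by gcongr
    _ = 1 := by rw [← ENNReal.ofReal_mul (by positivity), inv_mul_cancel₀ hT0.ne']; simp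

end Lux

/-! ### Classical partial derivatives -/

section Deriv

variable {d : ℕ}

theorem contDiff_partialDeriv {f : Space d → ℝ} (hf : ContDiff ℝ ∞ f) (i : Fin d) :
    ContDiff ℝ ∞ (partialDeriv i f) :=
  (hf.fderiv_right (m := ∞) le_rfl).clm_apply contDiff_const

theorem hasCompactSupport_partialDeriv {f : Space d → ℝ} (hf : HasCompactSupport f) (i : Fin d) :
    HasCompactSupport (partialDeriv i f) :=
  (hf.fderiv (𝕜 := ℝ)).comp_left (g := fun L : Space d →L[ℝ] ℝ => L (EuclideanSpace.single i 1))
    (by simp)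

/-- Induction principle: a relation that is preserved by each `∂_i` is preserved by `∂_α`. The
index counts derivatives. -/
theorem multiDeriv_rel (R : ℕ → (Space d → ℝ) → (Space d → ℝ) → Prop)
    (step : ∀ n f g i, R n f g → R (n + 1) (partialDeriv i f) (partialDeriv i g))
    {f g : Space d → ℝ} (h : R 0 f g) (α : Fin d → ℕ) :
    R (∑ i, α i) (multiDeriv α f) (multiDeriv α g) := by
  have iter : ∀ i m n f g, R n f g →
      R (n + m) ((partialDeriv i)^[m] f) ((partialDeriv i)^[m] g) := by
    intro i m
    induction m with
    | zero => intro n f g h; simpa using h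
    | succ m ih =>
      intro n f g h
      rw [Function.iterate_succ_apply, Function.iterate_succ_apply]
      have := ih _ _ _ (step n f g i h)
      rwa [add_assoc, add_comm 1 m] at this
  have main : ∀ l : List (Fin d), R ((l.map α).sum)
      (l.foldr (fun i g => (partialDeriv i)^[α i] g) f)
      (l.foldr (fun i g => (partialDeriv i)^[α i] g) g) := by
    intro l
    induction l with
    | nil => simpa using h
    | cons i l ih =>
      simp only [List.map_cons, List.sum_cons, List.foldr_cons]
      rw [add_comm]
      exact iter _ _ _ _ _ ih
  rw [Fin.sum_univ_def]
  exact main _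

theorem contDiff_multiDeriv {f : Space d → ℝ} (hf : ContDiff ℝ ∞ f) (α : Fin d → ℕ) :
    ContDiff ℝ ∞ (multiDeriv α f) :=
  multiDeriv_rel (fun _ f _ => ContDiff ℝ ∞ f) (fun _ _ _ i h => contDiff_partialDeriv h i)
    (g := f) hf α

theorem hasCompactSupport_multiDeriv {f : Space d → ℝ} (hf : HasCompactSupport f)
    (α : Fin d → ℕ) : HasCompactSupport (multiDeriv α f) :=
  multiDeriv_rel (fun _ f _ => HasCompactSupport f)
    (fun _ _ _ i h => hasCompactSupport_partialDeriv h i) (g := f) hf α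

theorem partialDeriv_const_mul {f : Space d → ℝ} (hf : ContDiff ℝ ∞ f) (a : ℝ) (i : Fin d) :
    partialDeriv i (fun x => a * f x) = fun x => a * partialDeriv i f x := by
  funext x
  simp only [partialDeriv]
  rw [fderiv_const_mul (hf.differentiable (by simp) x)]
  simp

theorem multiDeriv_const_mul {f : Space d → ℝ} (hf : ContDiff ℝ ∞ f) (a : ℝ) (α : Fin d → ℕ) :
    multiDeriv α (fun x => a * f x) = fun x => a * multiDeriv α f x := by
  refine (multiDeriv_rel (fun _ f g => ContDiff ℝ ∞ g ∧ f = fun x => a * g x) ?_ ⟨hf, rfl⟩ α).2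
  rintro n _ g i ⟨hg, rfl⟩
  exact ⟨contDiff_partialDeriv hg i, partialDeriv_const_mul hg a i⟩

theorem partialDeriv_comp_affine {f : Space d → ℝ} (hf : ContDiff ℝ ∞ f) (c : ℝ) (v : Space d)
    (i : Fin d) :
    partialDeriv i (fun x => f (c • x + v)) = fun x => c * partialDeriv i f (c • x + v) := by
  funext x
  have h1 : HasFDerivAt (fun x : Space d => c • x + v)
      (c • ContinuousLinearMap.id ℝ (Space d)) x :=
    ((hasFDerivAt_id x).const_smul c).add_const v
  have h2 := ((hf.differentiable (by simp) (c • x + v)).hasFDerivAt).comp x h1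
  simp only [partialDeriv]
  rw [show (fun x => f (c • x + v)) = f ∘ fun x => c • x + v from rfl, h2.fderiv]
  simp

theorem multiDeriv_comp_affine {f : Space d → ℝ} (hf : ContDiff ℝ ∞ f) (c : ℝ) (v : Space d)
    (α : Fin d → ℕ) :
    multiDeriv α (fun x => f (c • x + v)) =
      fun x => c ^ (∑ i, α i) * multiDeriv α f (c • x + v) := by
  refine (multiDeriv_rel (fun n f g => ContDiff ℝ ∞ g ∧ f = fun x => c ^ n * g (c • x + v))
    ?_ ⟨hf, by simp⟩ α).2
  rintro n _ g i ⟨hg, rfl⟩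
  refine ⟨contDiff_partialDeriv hg i, ?_⟩
  have hga : ContDiff ℝ ∞ fun x => g (c • x + v) := hg.comp (by fun_prop)
  rw [partialDeriv_const_mul hga, partialDeriv_comp_affine hg]
  funext x
  ring

theorem multiDeriv_comp_const_sub {f : Space d → ℝ} (hf : ContDiff ℝ ∞ f) (x : Space d)
    (α : Fin d → ℕ) :
    multiDeriv α (fun y => f (x - y)) = fun y => (-1) ^ (∑ i, α i) * multiDeriv α f (x - y) := by
  have := multiDeriv_comp_affine hf (-1) x α
  simpa only [neg_smul, one_smul, neg_add_eq_sub] using this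

end Deriv

/-! ### Correlation with a kernel -/

section Corr

variable {d : ℕ}

/-- The correlation `y ↦ ∫ k(x - y) g(x) dx`, the adjoint of the convolution with `k`. -/
noncomputable def corr (k g : Space d → ℝ) (y : Space d) : ℝ := ∫ x, k (x - y) * g x

theorem corr_eq_convolution (k g : Space d → ℝ) :
    corr k g = convolution g (fun z => k (-z)) (ContinuousLinearMap.mul ℝ ℝ) volume := by
  funext y
  simp only [corr, convolution, ContinuousLinearMap.mul_apply', neg_sub, mul_comm]

theorem corr_eq_integral_add (k g : Space d → ℝ) (y : Space d) :
    corr k g y = ∫ z, k z * g (y + z) := by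
  rw [corr, ← integral_add_right_eq_self _ y]
  simp [add_comm]

theorem corr_eq_convolution' (k g : Space d → ℝ) :
    corr k g = convolution (fun z => k (-z)) g (ContinuousLinearMap.mul ℝ ℝ) volume := by
  funext y
  rw [corr_eq_integral_add, ← integral_neg_eq_self]
  simp only [convolution, ContinuousLinearMap.mul_apply', sub_eq_add_neg]

theorem hasCompactSupport_comp_neg {k : Space d → ℝ} (hk : HasCompactSupport k) :
    HasCompactSupport fun z => k (-z) :=
  hk.comp_homeomorph (Homeomorph.neg _)

theorem contDiff_corr {k g : Space d → ℝ} (hk : ContDiff ℝ ∞ k) (hkc : HasCompactSupport k)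
    (hg : LocallyIntegrable g volume) : ContDiff ℝ ∞ (corr k g) := by
  rw [corr_eq_convolution]
  exact (hasCompactSupport_comp_neg hkc).contDiff_convolution_right _ hg (hk.comp contDiff_neg)

theorem partialDeriv_convolution {u k : Space d → ℝ} (hu : LocallyIntegrable u volume)
    (hk : ContDiff ℝ ∞ k) (hkc : HasCompactSupport k) (i : Fin d) :
    partialDeriv i (convolution u k (ContinuousLinearMap.mul ℝ ℝ) volume) =
      convolution u (partialDeriv i k) (ContinuousLinearMap.mul ℝ ℝ) volume := by
  funext y
  rw [partialDeriv, (hkc.hasFDerivAt_convolution_right _ hu (hk.of_le (by simp)) y).fderiv,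
    convolution_precompR_apply _ hu (hkc.fderiv (𝕜 := ℝ)) (hk.continuous_fderiv (by simp))]
  rfl

theorem partialDeriv_corr_left {k g : Space d → ℝ} (hk : ContDiff ℝ ∞ k)
    (hkc : HasCompactSupport k) (hg : LocallyIntegrable g volume) (i : Fin d) :
    partialDeriv i (corr k g) = fun y => -corr (partialDeriv i k) g y := by
  have hkn : ContDiff ℝ ∞ fun z => k (-z) := hk.comp contDiff_neg
  rw [corr_eq_convolution, partialDeriv_convolution hg hkn
    (hasCompactSupport_comp_neg hkc), corr_eq_convolution]
  have := partialDeriv_comp_affine hk (-1) 0 i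
  simp only [neg_smul, one_smul, add_zero, neg_mul, one_mul] at this
  rw [this]
  funext y
  simp only [convolution, ContinuousLinearMap.mul_apply', mul_neg, integral_neg]

theorem multiDeriv_corr_left {k g : Space d → ℝ} (hk : ContDiff ℝ ∞ k)
    (hkc : HasCompactSupport k) (hg : LocallyIntegrable g volume) (α : Fin d → ℕ) :
    multiDeriv α (corr k g) = fun y => (-1) ^ (∑ i, α i) * corr (multiDeriv α k) g y := by
  refine (multiDeriv_rel (fun n f k => ContDiff ℝ ∞ k ∧ HasCompactSupport k ∧
    f = fun y => (-1) ^ n * corr k g y) ?_ ⟨hk, hkc, by simp⟩ α).2.2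
  rintro n _ k i ⟨hk, hkc, rfl⟩
  refine ⟨contDiff_partialDeriv hk i, hasCompactSupport_partialDeriv hkc i, ?_⟩
  rw [partialDeriv_const_mul (contDiff_corr hk hkc hg), partialDeriv_corr_left hk hkc hg]
  funext y
  ring

theorem multiDeriv_corr_right {k g : Space d → ℝ} (hk : Continuous k)
    (hg : ContDiff ℝ ∞ g) (hgc : HasCompactSupport g) (α : Fin d → ℕ) :
    multiDeriv α (corr k g) = corr k (multiDeriv α g) := by
  refine (multiDeriv_rel (fun n f g => ContDiff ℝ ∞ g ∧ HasCompactSupport g ∧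
    f = corr k g) ?_ ⟨hg, hgc, rfl⟩ α).2.2
  rintro n _ g i ⟨hg, hgc, rfl⟩
  refine ⟨contDiff_partialDeriv hg i, hasCompactSupport_partialDeriv hgc i, ?_⟩
  have hkn : Continuous fun z => k (-z) := hk.comp continuous_neg
  rw [corr_eq_convolution', partialDeriv_convolution hkn.locallyIntegrable hg hgc,
    corr_eq_convolution']

/-- Integration by parts. Moving the derivatives through the correlation, instead of one by one
across the integral, keeps their order. -/
theorem corr_multiDeriv {k g : Space d → ℝ} (hk : ContDiff ℝ ∞ k) (hkc : HasCompactSupport k)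
    (hg : ContDiff ℝ ∞ g) (hgc : HasCompactSupport g) (α : Fin d → ℕ) (y : Space d) :
    corr (multiDeriv α k) g y = (-1) ^ (∑ i, α i) * corr k (multiDeriv α g) y := by
  rw [← multiDeriv_corr_right hk.continuous hg hgc,
    multiDeriv_corr_left hk hkc hg.continuous.locallyIntegrable]
  simp only
  rw [← mul_assoc, ← mul_pow]
  simp

theorem abs_corr_le {k g : Space d → ℝ} (hk : Continuous k) (hkc : HasCompactSupport k)
    {B : ℝ} (hg : ∀ x, |g x| ≤ B) (y : Space d) : |corr k g y| ≤ B * ∫ x, |k x| := by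
  have hi : Integrable (fun x => |k x|) volume := (hk.integrable_of_hasCompactSupport hkc).abs
  calc |corr k g y| = ‖∫ z, k z * g (y + z)‖ := by rw [corr_eq_integral_add, Real.norm_eq_abs]
    _ ≤ ∫ z, B * |k z| := by
        refine norm_integral_le_of_norm_le (hi.const_mul B) (.of_forall fun z => ?_)
        rw [Real.norm_eq_abs, abs_mul, mul_comm]
        gcongr
        exact hg _
    _ = B * ∫ x, |k x| := integral_const_mul _ _

end Corr

/-! ### Dilated kernels -/

section Dil

variable {d : ℕ}

/-- The `L¹`-normalized dilation `r^d k(r x)`. -/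
noncomputable def dil (r : ℝ) (k : Space d → ℝ) (x : Space d) : ℝ := r ^ d * k (r • x)

theorem contDiff_dil {k : Space d → ℝ} (hk : ContDiff ℝ ∞ k) (r : ℝ) : ContDiff ℝ ∞ (dil r k) :=
  contDiff_const.mul (hk.comp (contDiff_const_smul r))

theorem hasCompactSupport_dil {k : Space d → ℝ} (hk : HasCompactSupport k) {r : ℝ} (hr : r ≠ 0) :
    HasCompactSupport (dil r k) :=
  (hk.comp_smul hr).mul_left

theorem multiDeriv_dil {k : Space d → ℝ} (hk : ContDiff ℝ ∞ k) (r : ℝ) (α : Fin d → ℕ) :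
    multiDeriv α (dil r k) = fun x => r ^ (∑ i, α i) * dil r (multiDeriv α k) x := by
  have h1 := multiDeriv_comp_affine hk r 0 α
  simp only [add_zero] at h1
  have h2 := multiDeriv_const_mul (hk.comp (contDiff_const_smul r)) (r ^ d) α
  simp only [Function.comp_def] at h2
  rw [h1] at h2
  funext x
  refine (congrFun h2 x).trans ?_
  simp only [dil]
  ring

theorem integral_abs_dil (k : Space d → ℝ) {r : ℝ} (hr : 0 < r) :
    ∫ x, |dil r k x| = ∫ x, |k x| := by
  simp only [dil, abs_mul, abs_of_pos (pow_pos hr d)]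
  rw [integral_const_mul, Measure.integral_comp_smul volume (fun x => |k x|) r]
  simp only [finrank_euclideanSpace, Fintype.card_fin, smul_eq_mul]
  rw [abs_of_pos (by positivity), mul_inv_cancel_left₀ (by positivity)]

theorem corr_dil (k g : Space d → ℝ) {r : ℝ} (hr : 0 < r) (y : Space d) :
    corr (dil r k) g y = ∫ z, k z * g (y + r⁻¹ • z) := by
  rw [corr_eq_integral_add]
  have := Measure.integral_comp_smul volume (fun z => k z * g (y + r⁻¹ • z)) r
  simp only [finrank_euclideanSpace, Fintype.card_fin, smul_eq_mul, smul_smul,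
    inv_mul_cancel₀ hr.ne', one_smul] at this
  rw [abs_of_pos (by positivity)] at this
  simp only [dil, mul_assoc]
  rw [integral_const_mul, this, mul_inv_cancel_left₀ (by positivity)]

theorem tendsto_corr_dil {k g : Space d → ℝ} (hk : Continuous k) (hkc : HasCompactSupport k)
    (hk1 : ∫ x, k x = 1) (hg : Continuous g) {B : ℝ} (hB : ∀ x, |g x| ≤ B) (y : Space d) :
    Filter.Tendsto (fun n : ℕ => corr (dil (2 ^ n) k) g y) Filter.atTop (nhds (g y)) := by
  have hi : Integrable k volume := hk.integrable_of_hasCompactSupport hkc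
  have hlim : g y = ∫ z, k z * g y := by rw [integral_mul_const, hk1, one_mul]
  have hfun : (fun n : ℕ => corr (dil (2 ^ n) k) g y) =
      fun n : ℕ => ∫ z, k z * g (y + ((2 : ℝ) ^ n)⁻¹ • z) :=
    funext fun n => corr_dil k g (by positivity) y
  rw [hfun, hlim]
  refine tendsto_integral_of_dominated_convergence (fun z => B * |k z|) (fun n => ?_)
    (hi.abs.const_mul B) (fun n => .of_forall fun z => ?_) (.of_forall fun z => ?_)
  · exact (hk.mul (hg.comp (by fun_prop))).aestronglyMeasurable
  · rw [Real.norm_eq_abs, abs_mul, mul_comm]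
    gcongr
    exact hB _
  · have h0 : Filter.Tendsto (fun n : ℕ => ((2 : ℝ) ^ n)⁻¹) Filter.atTop (nhds 0) := by
      simp only [← inv_pow]
      exact tendsto_pow_atTop_nhds_zero_of_lt_one (by norm_num) (by norm_num)
    have h1 : Filter.Tendsto (fun n : ℕ => y + ((2 : ℝ) ^ n)⁻¹ • z) Filter.atTop (nhds y) := by
      simpa using (h0.smul_const z).const_add y
    exact ((hg.tendsto y).comp h1).const_mul (k z)

end Dil

/-! ### Kernels on the line with vanishing moments -/

section Line

theorem contDiff_dilate {f : ℝ → ℝ} (hf : ContDiff ℝ ∞ f) :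
    ContDiff ℝ ∞ fun x : ℝ => 2 * f (2 * x) :=
  contDiff_const.mul (hf.comp (contDiff_const.mul contDiff_id))

theorem hasCompactSupport_dilate {f : ℝ → ℝ} (hf : HasCompactSupport f) :
    HasCompactSupport fun x : ℝ => 2 * f (2 * x) :=
  HasCompactSupport.mul_left (f := fun _ : ℝ => (2 : ℝ))
    (hf.comp_homeomorph (Homeomorph.mulLeft₀ (2 : ℝ) two_ne_zero))

theorem integral_pow_mul_dilate (f : ℝ → ℝ) (j : ℕ) :
    ∫ x, x ^ j * (2 * f (2 * x)) = (1 / 2) ^ j * ∫ x, x ^ j * f x := by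
  have h := Measure.integral_comp_mul_left (fun x => x ^ j * f x) 2
  have hfun : (fun x : ℝ => x ^ j * (2 * f (2 * x))) =
      fun x => 2 * (1 / 2) ^ j * ((2 * x) ^ j * f (2 * x)) := by
    funext x
    rw [mul_pow]
    have : ((1 : ℝ) / 2) ^ j * 2 ^ j = 1 := by rw [← mul_pow]; norm_num
    linear_combination (-(x ^ j * 2 * f (2 * x))) * this
  rw [hfun, integral_const_mul, h]
  norm_num
  ring

theorem integrable_pow_mul {f : ℝ → ℝ} (hf : Continuous f) (hfc : HasCompactSupport f) (j : ℕ) :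
    Integrable fun x => x ^ j * f x :=
  ((continuous_pow j).mul hf).integrable_of_hasCompactSupport hfc.mul_left

/-- A smooth compactly supported kernel of mass one whose moments of orders `1, …, N` vanish. The
combination `(2^j · 2κ(2x) - κ(x)) / (2^j - 1)` keeps the mass and kills the `j`-th moment. -/
theorem exists_kernel_moments (N : ℕ) :
    ∃ κ : ℝ → ℝ, ContDiff ℝ ∞ κ ∧ HasCompactSupport κ ∧ ∫ x, κ x = 1 ∧
      ∀ j, 1 ≤ j → j ≤ N → ∫ x, x ^ j * κ x = 0 := by
  induction N with
  | zero =>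
    let φ : ContDiffBump (0 : ℝ) := ⟨1, 2, one_pos, one_lt_two⟩
    exact ⟨φ.normed volume, φ.contDiff_normed, φ.hasCompactSupport_normed, φ.integral_normed,
      fun j h1 h2 => by omega⟩
  | succ N ih =>
    obtain ⟨κ, hκ, hκc, h1, hm⟩ := ih
    have hD : ContDiff ℝ ∞ fun x : ℝ => 2 * κ (2 * x) :=
      contDiff_dilate hκ
    have hDc : HasCompactSupport fun x : ℝ => 2 * κ (2 * x) :=
      hasCompactSupport_dilate hκc
    set A : ℝ := 2 ^ (N + 1) with hA
    have hA1 : A - 1 ≠ 0 := by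
      have : (1 : ℝ) < A := one_lt_pow₀ (by norm_num) (by omega)
      linarith
    have hmom : ∀ j, ∫ x, x ^ j * ((A - 1)⁻¹ * (A * (2 * κ (2 * x)) - κ x)) =
        (A - 1)⁻¹ * (A * (1 / 2) ^ j - 1) * ∫ x, x ^ j * κ x := fun j => by
      have hfun : (fun x : ℝ => x ^ j * ((A - 1)⁻¹ * (A * (2 * κ (2 * x)) - κ x))) =
          fun x => (A - 1)⁻¹ * (A * (x ^ j * (2 * κ (2 * x))) - x ^ j * κ x) := by
        funext x; ring
      rw [hfun, integral_const_mul, integral_sub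
        ((integrable_pow_mul hD.continuous hDc j).const_mul A)
        (integrable_pow_mul hκ.continuous hκc j), integral_const_mul, integral_pow_mul_dilate]
      ring
    refine ⟨fun x => (A - 1)⁻¹ * (A * (2 * κ (2 * x)) - κ x), ?_, ?_, ?_, ?_⟩
    · exact contDiff_const.mul ((contDiff_const.mul hD).sub hκ)
    · exact HasCompactSupport.mul_left (f := fun _ : ℝ => (A - 1)⁻¹)
        ((HasCompactSupport.mul_left (f := fun _ : ℝ => A) hDc).sub hκc)
    · have := hmom 0
      simp only [pow_zero, one_mul, mul_one, h1] at this
      rw [this, inv_mul_cancel₀ hA1]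
    · intro j hj1 hj2
      rw [hmom]
      rcases eq_or_lt_of_le hj2 with rfl | hlt
      · rw [hA, ← mul_pow]
        norm_num
      · rw [hm j hj1 (by omega), mul_zero]

/-- A smooth compactly supported function with vanishing integral has a compactly supported
primitive. -/
theorem exists_primitive {ψ : ℝ → ℝ} (hψ : ContDiff ℝ ∞ ψ) (hψc : HasCompactSupport ψ)
    (h0 : ∫ x, ψ x = 0) :
    ∃ Ψ : ℝ → ℝ, ContDiff ℝ ∞ Ψ ∧ HasCompactSupport Ψ ∧ deriv Ψ = ψ := by
  obtain ⟨R, hR⟩ := hψc.isCompact.isBounded.subset_closedBall 0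
  have hout : ∀ x, R < |x| → ψ x = 0 := fun x hx => by
    by_contra hne
    have := hR (subset_tsupport ψ hne)
    rw [Metric.mem_closedBall, dist_zero_right, Real.norm_eq_abs] at this
    linarith
  have hi := hψ.continuous.integrable_of_hasCompactSupport hψc (μ := volume)
  have hder : ∀ x, HasDerivAt (fun x => ∫ t in Set.Iic x, ψ t) (ψ x) x := fun x => by
    have hfun : (fun x => ∫ t in Set.Iic x, ψ t) =
        fun x => (∫ t in Set.Iic 0, ψ t) + ∫ t in (0 : ℝ)..x, ψ t := by
      funext x
      rw [← intervalIntegral.integral_Iic_sub_Iic hi.integrableOn hi.integrableOn]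
      ring
    rw [hfun]
    exact (intervalIntegral.integral_hasDerivAt_right (hψ.continuous.intervalIntegrable _ _)
      (hψ.continuous.stronglyMeasurableAtFilter _ _) hψ.continuous.continuousAt).const_add _
  have hderiv : deriv (fun x => ∫ t in Set.Iic x, ψ t) = ψ := funext fun x => (hder x).deriv
  refine ⟨fun x => ∫ t in Set.Iic x, ψ t, ?_, ?_, hderiv⟩
  · rw [contDiff_infty_iff_deriv, hderiv]
    exact ⟨fun x => (hder x).differentiableAt, hψ⟩
  · refine HasCompactSupport.intro (isCompact_Icc (a := -|R|) (b := |R|)) fun x hx => ?_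
    have hRR := le_abs_self R
    rw [Set.mem_Icc, not_and_or, not_le, not_le] at hx
    rcases hx with hx | hx
    · refine setIntegral_eq_zero_of_forall_eq_zero fun t ht => hout t ?_
      have : t ≤ x := ht
      have := neg_abs_le t
      linarith
    · have h1 := integral_add_compl (measurableSet_Iic (a := x)) hi
      have h2 : ∫ t in (Set.Iic x)ᶜ, ψ t = 0 := by
        refine setIntegral_eq_zero_of_forall_eq_zero fun t ht => hout t ?_
        have : x < t := by simpa using ht
        have := le_abs_self t
        linarith
      rw [h2, h0, add_zero] at h1
      exact h1

theorem integral_pow_mul_of_deriv {Ψ : ℝ → ℝ} (hΨ : ContDiff ℝ ∞ Ψ) (hΨc : HasCompactSupport Ψ)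
    (j : ℕ) : ∫ x, x ^ (j + 1) * deriv Ψ x = -((j + 1) * ∫ x, x ^ j * Ψ x) := by
  have hd : Continuous (deriv Ψ) := hΨ.continuous_deriv (by simp)
  have h := integral_mul_deriv_eq_deriv_mul_of_integrable (u := fun x : ℝ => x ^ (j + 1)) (v := Ψ)
    (u' := fun x => (j + 1) * x ^ j) (v' := deriv Ψ)
    (fun x _ => by simpa using hasDerivAt_pow (j + 1) x)
    (fun x _ => (hΨ.differentiable (by simp) x).hasDerivAt)
    (integrable_pow_mul hd hΨc.deriv _)
    (by
      have := (integrable_pow_mul hΨ.continuous hΨc j).const_mul ((j : ℝ) + 1)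
      simpa only [Pi.mul_def, mul_assoc] using this)
    (integrable_pow_mul hΨ.continuous hΨc _)
  rw [h]
  simp only [mul_assoc]
  rw [integral_const_mul]

/-- A smooth compactly supported function whose moments of orders `0, …, N - 1` vanish is the
`N`-th derivative of a smooth compactly supported function. -/
theorem exists_iteratedDeriv_eq (N : ℕ) {ψ : ℝ → ℝ} (hψ : ContDiff ℝ ∞ ψ)
    (hψc : HasCompactSupport ψ) (hm : ∀ j < N, ∫ x, x ^ j * ψ x = 0) :
    ∃ θ : ℝ → ℝ, ContDiff ℝ ∞ θ ∧ HasCompactSupport θ ∧ iteratedDeriv N θ = ψ := by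
  induction N generalizing ψ with
  | zero => exact ⟨ψ, hψ, hψc, iteratedDeriv_zero⟩
  | succ N ih =>
    obtain ⟨Ψ, hΨ, hΨc, hd⟩ := exists_primitive hψ hψc (by simpa using hm 0 (by omega))
    obtain ⟨θ, hθ, hθc, h⟩ := ih hΨ hΨc fun j hj => by
      have h1 := hm (j + 1) (by omega)
      rw [← hd, integral_pow_mul_of_deriv hΨ hΨc, neg_eq_zero, mul_eq_zero] at h1
      exact h1.resolve_left (by positivity)
    exact ⟨θ, hθ, hθc, by rw [iteratedDeriv_succ, h, hd]⟩

/-- A mollifier on the line such that passing from one dyadic scale to the next amounts to the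
`N`-th derivative of a smooth compactly supported function. -/
theorem exists_line_kernel (N : ℕ) :
    ∃ κ θ : ℝ → ℝ, ContDiff ℝ ∞ κ ∧ HasCompactSupport κ ∧ ∫ x, κ x = 1 ∧
      ContDiff ℝ ∞ θ ∧ HasCompactSupport θ ∧
      iteratedDeriv N θ = fun x => 2 * κ (2 * x) - κ x := by
  obtain ⟨κ, hκ, hκc, h1, hm⟩ := exists_kernel_moments N
  have hD : ContDiff ℝ ∞ fun x : ℝ => 2 * κ (2 * x) :=
    contDiff_dilate hκ
  have hDc : HasCompactSupport fun x : ℝ => 2 * κ (2 * x) :=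
    hasCompactSupport_dilate hκc
  obtain ⟨θ, hθ, hθc, h⟩ := exists_iteratedDeriv_eq N (hD.sub hκ) (hDc.sub hκc) fun j hj => by
    simp only [mul_sub]
    rw [integral_sub (integrable_pow_mul hD.continuous hDc j)
      (integrable_pow_mul hκ.continuous hκc j), integral_pow_mul_dilate]
    rcases Nat.eq_zero_or_pos j with rfl | hj0
    · simp
    · rw [hm j hj0 hj.le]
      simp
  exact ⟨κ, θ, hκ, hκc, h1, hθ, hθc, h⟩

end Line

/-! ### Tensor product kernels -/

section Tensor

variable {d : ℕ}

/-- The tensor product `x ↦ ∏ κ_i(x_i)`. -/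
def tens (κ : Fin d → ℝ → ℝ) (x : Space d) : ℝ := ∏ i, κ i (x i)

theorem contDiff_tens {κ : Fin d → ℝ → ℝ} (hκ : ∀ i, ContDiff ℝ ∞ (κ i)) :
    ContDiff ℝ ∞ (tens κ) :=
  contDiff_prod fun i _ => (hκ i).comp (contDiff_piLp_apply 2 (i := i))

theorem hasCompactSupport_tens {κ : Fin d → ℝ → ℝ} (hκ : ∀ i, HasCompactSupport (κ i)) :
    HasCompactSupport (tens κ) := by
  have hK : IsCompact ((EuclideanSpace.equiv (Fin d) ℝ).symm ''
      Set.univ.pi fun i => tsupport (κ i)) :=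
    (isCompact_univ_pi fun i => (hκ i).isCompact).image
      (EuclideanSpace.equiv (Fin d) ℝ).symm.continuous
  refine HasCompactSupport.intro hK fun x hx => ?_
  by_contra hne
  refine hx ⟨EuclideanSpace.equiv (Fin d) ℝ x, fun i _ => subset_tsupport _ ?_, by simp⟩
  exact Finset.prod_ne_zero_iff.1 hne i (Finset.mem_univ i)

theorem integral_tens (κ : Fin d → ℝ → ℝ) : ∫ x, tens κ x = ∏ i, ∫ t, κ i t := by
  rw [← integral_fintype_prod_volume_eq_prod]
  exact (EuclideanSpace.volume_preserving_symm_measurableEquiv_toLp (Fin d)).integral_comp'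
    (fun y : Fin d → ℝ => ∏ i, κ i (y i))

theorem partialDeriv_tens {κ : Fin d → ℝ → ℝ} (hκ : ∀ i, ContDiff ℝ ∞ (κ i)) (i : Fin d) :
    partialDeriv i (tens κ) = tens (Function.update κ i (deriv (κ i))) := by
  funext x
  have h1 : ∀ j ∈ (Finset.univ : Finset (Fin d)), HasFDerivAt (fun x : Space d => κ j (x j))
      (deriv (κ j) (x j) • (EuclideanSpace.proj j : Space d →L[ℝ] ℝ)) x := fun j _ =>
    (((hκ j).differentiable (by simp) (x j)).hasDerivAt).comp_hasFDerivAt x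
      ((EuclideanSpace.proj j : Space d →L[ℝ] ℝ).hasFDerivAt)
  have h2 := HasFDerivAt.finsetProd h1
  rw [partialDeriv, show tens κ = fun x => ∏ j, κ j (x j) from rfl, h2.fderiv]
  have h3 : ∀ j, (EuclideanSpace.proj j : Space d →L[ℝ] ℝ) (EuclideanSpace.single i 1) =
      if j = i then 1 else 0 := fun j => by simp
  simp only [FunLike.coe_sum, Finset.sum_apply, FunLike.coe_smul, Pi.smul_apply, smul_eq_mul, h3]
  rw [Finset.sum_eq_single i (fun j _ hj => by simp [hj]) (by simp), tens,
    ← Finset.mul_prod_erase _ _ (Finset.mem_univ i)]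
  simp only [Function.update_self, if_true, mul_one]
  rw [mul_comm]
  congr 1
  exact Finset.prod_congr rfl fun j hj => by rw [Function.update_of_ne (Finset.ne_of_mem_erase hj)]

theorem iterate_partialDeriv_tens {κ : Fin d → ℝ → ℝ} (hκ : ∀ i, ContDiff ℝ ∞ (κ i)) (i : Fin d)
    (n : ℕ) (β : Fin d → ℕ) :
    (partialDeriv i)^[n] (tens fun j => iteratedDeriv (β j) (κ j)) =
      tens fun j => iteratedDeriv ((β + Pi.single i n : Fin d → ℕ) j) (κ j) := by
  induction n with
  | zero => simp
  | succ n ih =>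
    rw [Function.iterate_succ_apply', ih, partialDeriv_tens fun j => by
      rw [iteratedDeriv_eq_iterate]; exact (hκ j).iterate_deriv _]
    congr 1
    funext j
    by_cases hj : j = i
    · subst hj
      simp [← iteratedDeriv_succ, add_assoc]
    · simp [hj]

theorem multiDeriv_tens {κ : Fin d → ℝ → ℝ} (hκ : ∀ i, ContDiff ℝ ∞ (κ i)) (α : Fin d → ℕ) :
    multiDeriv α (tens κ) = tens fun i => iteratedDeriv (α i) (κ i) := by
  have main : ∀ l : List (Fin d), l.foldr (fun i g => (partialDeriv i)^[α i] g) (tens κ) =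
      tens fun j => iteratedDeriv ((l.map fun i => Pi.single i (α i)).sum j) (κ j) := by
    intro l
    induction l with
    | nil => simp
    | cons i l ih =>
      rw [List.foldr_cons, ih, iterate_partialDeriv_tens hκ, List.map_cons, List.sum_cons, add_comm]
  rw [multiDeriv, main]
  have : ((List.finRange d).map fun i => Pi.single i (α i)).sum = α := by
    rw [← Fin.sum_univ_def, Finset.univ_sum_single]
  rw [this]

/-- A mollifier on `ℝ^d` for which the difference of two consecutive dyadic scales is a sum of pure
`N`-th derivatives of smooth compactly supported functions. -/
theorem exists_kernel (d N : ℕ) :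
    ∃ (K : Space d → ℝ) (θ : Fin d → Space d → ℝ), ContDiff ℝ ∞ K ∧ HasCompactSupport K ∧
      ∫ x, K x = 1 ∧ (∀ i, ContDiff ℝ ∞ (θ i)) ∧ (∀ i, HasCompactSupport (θ i)) ∧
      ∀ α x, multiDeriv α (dil 2 K) x - multiDeriv α K x =
        ∑ i, multiDeriv (α + Pi.single i N) (θ i) x := by
  obtain ⟨κ, θ, hκ, hκc, h1, hθ, hθc, h⟩ := exists_line_kernel N
  have hD : ContDiff ℝ ∞ fun x : ℝ => 2 * κ (2 * x) :=
    contDiff_dilate hκ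
  have hDc : HasCompactSupport fun x : ℝ => 2 * κ (2 * x) :=
    hasCompactSupport_dilate hκc
  set κ₁ : ℝ → ℝ := fun x => 2 * κ (2 * x) with hκ₁
  let θ' : Fin d → Fin d → ℝ → ℝ := fun i j => if j = i then θ else if j < i then κ else κ₁
  have hθ' : ∀ i j, ContDiff ℝ ∞ (θ' i j) := fun i j => by
    simp only [θ']; split_ifs <;> assumption
  have hdil : dil 2 (tens fun _ : Fin d => κ) = tens fun _ => κ₁ := by
    funext x
    simp [dil, tens, hκ₁, Finset.prod_mul_distrib]
  refine ⟨tens fun _ => κ, fun i => tens (θ' i), contDiff_tens fun _ => hκ,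
    hasCompactSupport_tens fun _ => hκc, by simp [integral_tens, h1],
    fun i => contDiff_tens (hθ' i), fun i => hasCompactSupport_tens fun j => ?_, fun α x => ?_⟩
  · simp only [θ']; split_ifs <;> assumption
  rw [hdil, multiDeriv_tens fun _ => hD, multiDeriv_tens fun _ => hκ]
  have hdiff : ∀ i t, iteratedDeriv (α i + N) θ t =
      iteratedDeriv (α i) κ₁ t - iteratedDeriv (α i) κ t := fun i t => by
    have : iteratedDeriv (α i + N) θ = iteratedDeriv (α i) (κ₁ - κ) := by
      rw [iteratedDeriv_eq_iterate, Function.iterate_add_apply, ← iteratedDeriv_eq_iterate,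
        ← iteratedDeriv_eq_iterate, h]
      rfl
    rw [this, iteratedDeriv_sub (hD.of_le (by exact_mod_cast le_top)).contDiffAt
      (hκ.of_le (by exact_mod_cast le_top)).contDiffAt]
  -- telescope the product one coordinate at a time
  have htel := Finset.prod_sub_ordered (Finset.univ : Finset (Fin d))
    (fun i => iteratedDeriv (α i) κ₁ (x i))
    (fun i => iteratedDeriv (α i) κ₁ (x i) - iteratedDeriv (α i) κ (x i))
  simp only [sub_sub_cancel] at htel
  simp only [tens] at htel ⊢
  rw [htel, sub_sub_cancel]
  refine Finset.sum_congr rfl fun i _ => ?_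
  rw [multiDeriv_tens (hθ' i), tens, ← Finset.mul_prod_erase _ _ (Finset.mem_univ i), mul_assoc]
  congr 1
  · simp [θ', hdiff]
  · have hsplit : (Finset.univ : Finset (Fin d)).erase i =
        (Finset.univ.filter (· < i)) ∪ Finset.univ.filter (i < ·) := by
      ext j
      simp [lt_or_lt_iff_ne]
    have hdisj : Disjoint (Finset.univ.filter (· < i)) (Finset.univ.filter (i < ·)) :=
      Finset.disjoint_filter.2 fun j _ h1 h2 => lt_asymm h1 h2
    rw [hsplit, Finset.prod_union hdisj]
    congr 1
    · refine Finset.prod_congr rfl fun j hj => ?_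
      have hj : j < i := by simpa using hj
      simp [θ', hj.ne, hj]
    · refine Finset.prod_congr rfl fun j hj => ?_
      have hj : i < j := by simpa using hj
      simp [θ', hj.ne', hj.not_gt]

end Tensor

/-! ### Integration against signed measures -/

section SignedInt

variable {d : ℕ}

/-- The integral `∫ φ dμ⁺ - ∫ φ dμ⁻` along the Jordan decomposition. -/
noncomputable def signedInt (μ : SignedMeasure (Space d)) (φ : Space d → ℝ) : ℝ :=
  ∫ x, φ x ∂μ.toJordanDecomposition.posPart - ∫ x, φ x ∂μ.toJordanDecomposition.negPart

theorem integrable_of_bounded {a : Measure (Space d)} [IsFiniteMeasure a] {φ : Space d → ℝ}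
    (hφ : Continuous φ) {B : ℝ} (hB : ∀ x, |φ x| ≤ B) : Integrable φ a :=
  Integrable.of_bound hφ.aestronglyMeasurable B (.of_forall hB)

theorem vectorMeasure_integral_eq (μ : SignedMeasure (Space d)) {φ : Space d → ℝ}
    (hφ : Continuous φ) {B : ℝ} (hB : ∀ x, |φ x| ≤ B) :
    (∫ᵛ x, φ x ∂<•μ) = signedInt μ φ := by
  conv_lhs => rw [← μ.toSignedMeasure_toJordanDecomposition, JordanDecomposition.toSignedMeasure]
  rw [VectorMeasure.integral_sub_vectorMeasure, VectorMeasure.integral_toSignedMeasure,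
    VectorMeasure.integral_toSignedMeasure, signedInt]
  · rw [VectorMeasure.Integrable, Measure.variation_toSignedMeasure]
    exact integrable_of_bounded hφ hB
  · rw [VectorMeasure.Integrable, Measure.variation_toSignedMeasure]
    exact integrable_of_bounded hφ hB

theorem signedInt_const_mul (μ : SignedMeasure (Space d)) (a : ℝ) (φ : Space d → ℝ) :
    signedInt μ (fun x => a * φ x) = a * signedInt μ φ := by
  simp only [signedInt, integral_const_mul]
  ring

theorem signedInt_sub (μ : SignedMeasure (Space d)) {φ ψ : Space d → ℝ}
    (hφ : Continuous φ) {B : ℝ} (hB : ∀ x, |φ x| ≤ B)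
    (hψ : Continuous ψ) {B' : ℝ} (hB' : ∀ x, |ψ x| ≤ B') :
    signedInt μ (fun x => φ x - ψ x) = signedInt μ φ - signedInt μ ψ := by
  simp only [signedInt]
  rw [integral_sub (integrable_of_bounded hφ hB) (integrable_of_bounded hψ hB'),
    integral_sub (integrable_of_bounded hφ hB) (integrable_of_bounded hψ hB')]
  ring

theorem signedInt_sum (μ : SignedMeasure (Space d)) {ι : Type*} [Fintype ι]
    {φ : ι → Space d → ℝ} (hφ : ∀ i, Continuous (φ i)) {B : ι → ℝ} (hB : ∀ i x, |φ i x| ≤ B i) :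
    signedInt μ (fun x => ∑ i, φ i x) = ∑ i, signedInt μ (φ i) := by
  simp only [signedInt]
  rw [integral_finsetSum _ fun i _ => integrable_of_bounded (hφ i) (hB i),
    integral_finsetSum _ fun i _ => integrable_of_bounded (hφ i) (hB i), Finset.sum_sub_distrib]

/-- The integral against an absolutely continuous signed measure, in terms of its density. -/
theorem signedInt_eq_integral_density {ν : SignedMeasure (Space d)} (hν : AbsCont ν)
    {φ : Space d → ℝ} (hφ : Continuous φ) {B : ℝ} (hB : ∀ x, |φ x| ≤ B) :
    signedInt ν φ = ∫ x, φ x * density ν x := by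
  have hi : Integrable (density ν) volume := SignedMeasure.integrable_rnDeriv ν volume
  have h1 := (absCont_iff_withDensity ν).1 hν
  have := isFiniteMeasure_withDensity_ofReal hi.2
  have := isFiniteMeasure_withDensity_ofReal hi.neg.2
  rw [← vectorMeasure_integral_eq ν hφ hB]
  conv_lhs => rw [← h1, withDensityᵥ_eq_withDensity_pos_part_sub_withDensity_neg_part hi]
  have hm : Measurable (density ν) := SignedMeasure.measurable_rnDeriv ν volume
  have hmn : Measurable fun x => -density ν x := hm.neg
  rw [VectorMeasure.integral_sub_vectorMeasure, VectorMeasure.integral_toSignedMeasure,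
    VectorMeasure.integral_toSignedMeasure,
    integral_withDensity_eq_integral_toReal_smul hm.ennreal_ofReal
      (.of_forall fun _ => ENNReal.ofReal_lt_top),
    integral_withDensity_eq_integral_toReal_smul hmn.ennreal_ofReal
      (.of_forall fun _ => ENNReal.ofReal_lt_top), ← integral_sub]
  · refine integral_congr_ae (.of_forall fun x => ?_)
    simp only [ENNReal.toReal_ofReal', smul_eq_mul, ← sub_mul]
    rw [max_zero_sub_max_neg_zero_eq_self, mul_comm]
  · simp only [ENNReal.toReal_ofReal', smul_eq_mul]
    exact hi.pos_part.mul_bdd (c := B) hφ.aestronglyMeasurable (.of_forall hB)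
  · simp only [ENNReal.toReal_ofReal', smul_eq_mul]
    exact hi.neg_part.mul_bdd (c := B) hφ.aestronglyMeasurable (.of_forall hB)
  · rw [VectorMeasure.Integrable, Measure.variation_toSignedMeasure]
    exact integrable_of_bounded hφ hB
  · rw [VectorMeasure.Integrable, Measure.variation_toSignedMeasure]
    exact integrable_of_bounded hφ hB

/-- The norm includes the derivative of order zero. In particular the test functions of `d_k` are
bounded, hence integrable against finite measures. -/
theorem abs_le_of_supNorm_le {k : ℕ} {φ : Space d → ℝ} {B : ℝ} (hB : 0 ≤ B)
    (h : supNorm k φ ≤ ENNReal.ofReal B) (x : Space d) : |φ x| ≤ B := by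
  have h0 : (0 : Fin d → ℕ) ∈ multiIndices d k := mem_multiIndices.2 (by simp)
  have hd : multiDeriv 0 φ = φ := by simp [multiDeriv]
  have h1 : ENNReal.ofReal |multiDeriv 0 φ x| ≤ supNorm k φ :=
    (le_iSup (fun x => ENNReal.ofReal |multiDeriv 0 φ x|) x).trans
      (Finset.single_le_sum (f := fun α => ⨆ x, ENNReal.ofReal |multiDeriv α φ x|)
        (fun _ _ => bot_le) h0)
  rw [hd] at h1
  exact (ENNReal.ofReal_le_ofReal_iff hB).1 (h1.trans h)

theorem supNorm_le {k : ℕ} {φ : Space d → ℝ} {b : (Fin d → ℕ) → ℝ} (hb : ∀ β, 0 ≤ b β)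
    (h : ∀ β ∈ multiIndices d k, ∀ x, |multiDeriv β φ x| ≤ b β) :
    supNorm k φ ≤ ENNReal.ofReal (∑ β ∈ multiIndices d k, b β) := by
  rw [ENNReal.ofReal_sum_of_nonneg fun β _ => hb β]
  exact Finset.sum_le_sum fun β hβ => iSup_le fun x => ENNReal.ofReal_le_ofReal (h β hβ x)

/-- The defining bound of the distance `d_k`, scaled to test functions of arbitrary norm. -/
theorem abs_signedInt_sub_le {k : ℕ} {μ ν : SignedMeasure (Space d)} (hfin : measDist k μ ν ≠ ⊤)
    {φ : Space d → ℝ} (hφ : ContDiff ℝ ∞ φ) {B : ℝ} (hB : 0 < B)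
    (h : supNorm k φ ≤ ENNReal.ofReal B) :
    |signedInt μ φ - signedInt ν φ| ≤ B * (measDist k μ ν).toReal := by
  have hbd := abs_le_of_supNorm_le hB.le h
  have hs : ContDiff ℝ ∞ fun x => B⁻¹ * φ x := contDiff_const.mul hφ
  have hsup : supNorm k (fun x => B⁻¹ * φ x) ≤ 1 := by
    have : supNorm k (fun x => B⁻¹ * φ x) = ENNReal.ofReal B⁻¹ * supNorm k φ := by
      simp only [supNorm, multiDeriv_const_mul hφ, abs_mul, abs_of_pos (inv_pos.2 hB),
        ENNReal.ofReal_mul (inv_pos.2 hB).le, ← ENNReal.mul_iSup, Finset.mul_sum]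
    rw [this]
    calc _ ≤ ENNReal.ofReal B⁻¹ * ENNReal.ofReal B := by gcongr
      _ = 1 := by rw [← ENNReal.ofReal_mul (inv_pos.2 hB).le, inv_mul_cancel₀ hB.ne']; simp
  have h1 : ENNReal.ofReal |(∫ᵛ x, B⁻¹ * φ x ∂<•μ) - ∫ᵛ x, B⁻¹ * φ x ∂<•ν| ≤ measDist k μ ν :=
    le_iSup₂_of_le (fun x => B⁻¹ * φ x) ⟨hs, hsup⟩ le_rfl
  have hbs : ∀ x, |B⁻¹ * φ x| ≤ B⁻¹ * B := fun x => by
    rw [abs_mul, abs_of_pos (inv_pos.2 hB)]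
    gcongr
    exact hbd x
  rw [vectorMeasure_integral_eq μ hs.continuous hbs, vectorMeasure_integral_eq ν hs.continuous hbs,
    signedInt_const_mul, signedInt_const_mul, ← mul_sub, abs_mul, abs_of_pos (inv_pos.2 hB),
    ENNReal.ofReal_le_iff_le_toReal hfin, inv_mul_le_iff₀ hB] at h1
  exact h1

end SignedInt

/-! ### Mollified signed measures -/

section Moll

variable {d : ℕ}

/-- The convolution `x ↦ ∫ k(x - y) μ(dy)`. -/
noncomputable def moll (k : Space d → ℝ) (μ : SignedMeasure (Space d)) (x : Space d) : ℝ :=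
  signedInt μ fun y => k (x - y)

theorem continuous_moll {k : Space d → ℝ} (hk : Continuous k) (hkc : HasCompactSupport k)
    (μ : SignedMeasure (Space d)) : Continuous (moll k μ) := by
  obtain ⟨B, hB⟩ := hk.bounded_above_of_compact_support hkc
  refine Continuous.sub ?_ ?_ <;>
  exact continuous_of_dominated (bound := fun _ => B)
    (fun x => (hk.comp (continuous_const.sub continuous_id)).aestronglyMeasurable)
    (fun x => .of_forall fun y => hB _) (integrable_const B)
    (.of_forall fun y => hk.comp (continuous_id.sub continuous_const))

/-- The correlation is the adjoint of the convolution. -/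
theorem integral_moll_mul {k g : Space d → ℝ} (hk : Continuous k) (hkc : HasCompactSupport k)
    (hg : Integrable g volume) (μ : SignedMeasure (Space d)) :
    ∫ x, moll k μ x * g x = signedInt μ (corr k g) := by
  obtain ⟨B, hB⟩ := hk.bounded_above_of_compact_support hkc
  have hprod : ∀ a : Measure (Space d), IsFiniteMeasure a →
      Integrable (fun p : Space d × Space d => k (p.1 - p.2) * g p.1) (volume.prod a) :=
    fun a _ => (hg.comp_fst a).bdd_mul (c := B)
      (hk.comp (continuous_fst.sub continuous_snd)).aestronglyMeasurable
      (.of_forall fun p => hB _)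
  have hI : ∀ a : Measure (Space d), IsFiniteMeasure a →
      Integrable (fun x => (∫ y, k (x - y) ∂a) * g x) volume := fun a ha => by
    have := (hprod a ha).integral_prod_left
    simpa only [integral_mul_const] using this
  have hswap : ∀ a : Measure (Space d), IsFiniteMeasure a →
      ∫ x, (∫ y, k (x - y) ∂a) * g x = ∫ y, corr k g y ∂a := fun a ha => by
    simp only [← integral_mul_const, corr]
    exact integral_integral_swap (hprod a ha)
  simp only [moll, signedInt, sub_mul]
  rw [integral_sub (hI _ inferInstance) (hI _ inferInstance), hswap _ inferInstance,
    hswap _ inferInstance]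

/-- The mollification of the difference of two measures at scale `1 / r`, estimated in `L^∞` and,
by duality, in `L¹`, through the distance `d_k`. -/
theorem exists_moll_sub_bound {L : Space d → ℝ} (hL : ContDiff ℝ ∞ L) (hLc : HasCompactSupport L)
    (k : ℕ) : ∃ A : ℝ, 0 < A ∧ ∀ r : ℝ, 1 ≤ r → ∀ μ ν : SignedMeasure (Space d),
      measDist k μ ν ≠ ⊤ →
      (∀ x, |moll (dil r L) μ x - moll (dil r L) ν x| ≤
        A * r ^ k * (measDist k μ ν).toReal * r ^ d) ∧
      ∫⁻ x, ENNReal.ofReal |moll (dil r L) μ x - moll (dil r L) ν x| ≤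
        ENNReal.ofReal (A * r ^ k * (measDist k μ ν).toReal) := by
  have hbd : ∀ β : Fin d → ℕ, ∃ B, ∀ x, ‖multiDeriv β L x‖ ≤ B := fun β =>
    (contDiff_multiDeriv hL β).continuous.bounded_above_of_compact_support
      (hasCompactSupport_multiDeriv hLc β)
  choose B hB using hbd
  have hB0 : ∀ β, 0 ≤ B β := fun β => (norm_nonneg _).trans (hB β 0)
  set I : (Fin d → ℕ) → ℝ := fun β => ∫ x, |multiDeriv β L x| with hI
  have hI0 : ∀ β, 0 ≤ I β := fun β => integral_nonneg fun _ => abs_nonneg _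
  set A : ℝ := ∑ β ∈ multiIndices d k, (B β + I β) + 1 with hA
  have hA0 : 0 < A := by
    have : 0 ≤ ∑ β ∈ multiIndices d k, (B β + I β) :=
      Finset.sum_nonneg fun β _ => add_nonneg (hB0 β) (hI0 β)
    linarith
  have hAB : ∑ β ∈ multiIndices d k, B β ≤ A := by
    have := Finset.sum_le_sum fun β (_ : β ∈ multiIndices d k) =>
      (le_add_iff_nonneg_right (B β)).2 (hI0 β)
    linarith
  have hAI : ∑ β ∈ multiIndices d k, I β ≤ A := by
    have := Finset.sum_le_sum fun β (_ : β ∈ multiIndices d k) =>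
      (le_add_iff_nonneg_left (I β)).2 (hB0 β)
    linarith
  refine ⟨A, hA0, fun r hr μ ν hfin => ?_⟩
  have hr0 : 0 < r := one_pos.trans_le hr
  have hDL := contDiff_dil hL r
  have hDLc := hasCompactSupport_dil hLc hr0.ne'
  have hpow : ∀ β ∈ multiIndices d k, r ^ (∑ i, β i) ≤ r ^ k := fun β hβ =>
    pow_le_pow_right₀ hr (mem_multiIndices.1 hβ)
  have hmulti := fun β => multiDeriv_dil hL r β
  set δ := (measDist k μ ν).toReal
  have hδ : 0 ≤ δ := ENNReal.toReal_nonneg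
  set h := fun x => moll (dil r L) μ x - moll (dil r L) ν x with hh
  have hhc : Continuous h :=
    (continuous_moll hDL.continuous hDLc μ).sub (continuous_moll hDL.continuous hDLc ν)
  constructor
  · -- test with the translated and reflected kernel
    intro x
    have hφ : ContDiff ℝ ∞ fun y => dil r L (x - y) := hDL.comp (contDiff_const.sub contDiff_id)
    have hsup : supNorm k (fun y => dil r L (x - y)) ≤ ENNReal.ofReal (A * r ^ k * r ^ d) := by
      refine (supNorm_le (b := fun β => B β * r ^ (∑ i, β i) * r ^ d)
        (fun β => by have := hB0 β; positivity) fun β _ y => ?_).trans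
          (ENNReal.ofReal_le_ofReal ?_)
      · rw [multiDeriv_comp_const_sub hDL, hmulti]
        simp only [dil, abs_mul, abs_pow, abs_neg, abs_one, one_pow, one_mul, abs_of_pos hr0]
        have := hB β (r • (x - y))
        rw [Real.norm_eq_abs] at this
        calc r ^ (∑ i, β i) * (r ^ d * |multiDeriv β L (r • (x - y))|)
            ≤ r ^ (∑ i, β i) * (r ^ d * B β) := by gcongr
          _ = _ := by ring
      · rw [← Finset.sum_mul]
        gcongr
        calc ∑ β ∈ multiIndices d k, B β * r ^ (∑ i, β i)
            ≤ ∑ β ∈ multiIndices d k, B β * r ^ k :=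
              Finset.sum_le_sum fun β hβ => mul_le_mul_of_nonneg_left (hpow β hβ) (hB0 β)
          _ ≤ A * r ^ k := by rw [← Finset.sum_mul]; gcongr
    refine (abs_signedInt_sub_le hfin hφ (by positivity) hsup).trans (le_of_eq ?_)
    ring
  · -- test against the sign of `h`, cut off at a large radius
    have hball : ∀ n : ℕ, ∫⁻ x in Metric.ball 0 (n : ℝ), ENNReal.ofReal |h x| ≤
        ENNReal.ofReal (A * r ^ k * δ) := fun n => by
      set g : Space d → ℝ := (Metric.ball 0 (n : ℝ)).indicator fun x => h x / |h x|
        with hg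
      have hg1 : ∀ x, |g x| ≤ 1 := fun x => by
        by_cases hx : x ∈ Metric.ball (0 : Space d) n
        · rw [hg, Set.indicator_of_mem hx]
          rw [abs_div, abs_abs]
          exact div_self_le_one _
        · rw [hg, Set.indicator_of_notMem hx]
          simp
      have hgm : AEStronglyMeasurable g volume := by
        exact (hhc.measurable.div hhc.abs.measurable).aestronglyMeasurable.indicator
          measurableSet_ball
      have hgi : Integrable g volume := by
        refine IntegrableOn.integrable_of_forall_notMem_eq_zero (s := Metric.ball 0 (n : ℝ)) ?_
          fun x hx => Set.indicator_of_notMem hx _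
        exact Measure.integrableOn_of_bounded measure_ball_lt_top.ne hgm
          (M := 1) (.of_forall fun x => by simpa using hg1 x)
      have hφ := contDiff_corr hDL hDLc hgi.locallyIntegrable
      have hsup : supNorm k (corr (dil r L) g) ≤ ENNReal.ofReal (A * r ^ k) := by
        refine (supNorm_le (b := fun β => I β * r ^ (∑ i, β i))
          (fun β => by have := hI0 β; positivity) fun β _ y => ?_).trans
            (ENNReal.ofReal_le_ofReal ?_)
        · rw [multiDeriv_corr_left hDL hDLc hgi.locallyIntegrable]
          simp only [abs_mul, abs_pow, abs_neg, abs_one, one_pow, one_mul]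
          refine (abs_corr_le (contDiff_multiDeriv hDL β).continuous
            (hasCompactSupport_multiDeriv hDLc β) hg1 y).trans ?_
          rw [hmulti, one_mul]
          simp only [abs_mul, abs_pow, abs_of_pos hr0]
          rw [integral_const_mul, integral_abs_dil _ hr0, mul_comm]
        · calc ∑ β ∈ multiIndices d k, I β * r ^ (∑ i, β i)
              ≤ ∑ β ∈ multiIndices d k, I β * r ^ k :=
                Finset.sum_le_sum fun β hβ => mul_le_mul_of_nonneg_left (hpow β hβ) (hI0 β)
            _ ≤ A * r ^ k := by rw [← Finset.sum_mul]; gcongr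
      have key := abs_signedInt_sub_le hfin hφ (by positivity) hsup
      rw [← integral_moll_mul hDL.continuous hDLc hgi, ← integral_moll_mul hDL.continuous hDLc hgi]
        at key
      have hmi : ∀ μ : SignedMeasure (Space d),
          Integrable (fun x => moll (dil r L) μ x * g x) volume := fun μ => by
        refine IntegrableOn.integrable_of_forall_notMem_eq_zero (s := Metric.ball 0 (n : ℝ)) ?_
          fun x hx => by simp [hg, Set.indicator_of_notMem hx]
        refine Integrable.mul_bdd (c := 1) ?_ hgm.restrict (.of_forall hg1)
        exact ((continuous_moll hDL.continuous hDLc μ).locallyIntegrable.integrableOn_isCompact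
          (isCompact_closedBall 0 (n : ℝ))).mono_set Metric.ball_subset_closedBall
      rw [← integral_sub (hmi μ) (hmi ν)] at key
      have hind : (fun x => moll (dil r L) μ x * g x - moll (dil r L) ν x * g x) =
          (Metric.ball 0 (n : ℝ)).indicator fun x => |h x| := by
        funext x
        by_cases hx : x ∈ Metric.ball (0 : Space d) n
        · rw [Set.indicator_of_mem hx, hg, Set.indicator_of_mem hx, ← sub_mul]
          change h x * (h x / |h x|) = |h x|
          rw [← mul_div_assoc, ← abs_mul_abs_self, mul_self_div_self]
        · rw [Set.indicator_of_notMem hx, hg, Set.indicator_of_notMem hx]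
          simp
      rw [hind, integral_indicator measurableSet_ball] at key
      rw [← ofReal_integral_eq_lintegral_ofReal]
      · exact ENNReal.ofReal_le_ofReal ((le_abs_self _).trans key)
      · exact (hhc.abs.locallyIntegrable.integrableOn_isCompact
          (isCompact_closedBall 0 (n : ℝ))).mono_set Metric.ball_subset_closedBall
      · exact .of_forall fun _ => abs_nonneg _
    have hmono : Monotone fun n : ℕ => Metric.ball (0 : Space d) (n : ℝ) := fun a b hab =>
      Metric.ball_subset_ball (by exact_mod_cast hab)
    rw [← setLIntegral_univ, ← Metric.iUnion_ball_nat (0 : Space d),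
      setLIntegral_iUnion_of_directed _ hmono.directed_le]
    exact iSup_le hball

end Moll

/-! ### Estimates for the dyadic increments -/

section Increments

variable {d : ℕ} {e : ℝ → ℝ}

/-- The definition of the weak derivative, with `y ↦ θ(x - y)` as test function. -/
theorem moll_multiDeriv_eq {θ : Space d → ℝ} (hθ : ContDiff ℝ ∞ θ) (hθc : HasCompactSupport θ)
    {ν : SignedMeasure (Space d)} (hν : AbsCont ν) {β : Fin d → ℕ} {g : Space d → ℝ}
    (hg : HasWeakDeriv β (density ν) g) (x : Space d) :
    moll (multiDeriv β θ) ν x = ∫ y, θ (x - y) * g y := by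
  have hβ := (contDiff_multiDeriv hθ β).continuous
  obtain ⟨B, hB⟩ := hβ.bounded_above_of_compact_support (hasCompactSupport_multiDeriv hθc β)
  have hweak := hg.2.2 (fun y => θ (x - y)) (hθ.comp (contDiff_const.sub contDiff_id))
    (hθc.comp_homeomorph (Homeomorph.subLeft x))
  rw [multiDeriv_comp_const_sub hθ] at hweak
  have hβx : Continuous fun y => multiDeriv β θ (x - y) :=
    hβ.comp (continuous_const.sub continuous_id)
  rw [moll, signedInt_eq_integral_density hν hβx (fun y => hB (x - y))]
  have h1 : ∫ y, density ν y * ((-1) ^ (∑ i, β i) * multiDeriv β θ (x - y)) =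
      (-1) ^ (∑ i, β i) * ∫ y, multiDeriv β θ (x - y) * density ν y := by
    rw [← integral_const_mul]
    exact integral_congr_ae (.of_forall fun y => by ring)
  rw [h1] at hweak
  have := mul_left_cancel₀ (pow_ne_zero _ (by norm_num)) hweak
  rw [this]
  exact integral_congr_ae (.of_forall fun y => mul_comm _ _)

/-- The summand `1` keeps the constant positive, so that the bound is trivial when there is no weak
derivative and the right-hand side is infinite. -/
theorem luxNorm_moll_multiDeriv_le (he : YoungClass e) {θ : Space d → ℝ} (hθ : ContDiff ℝ ∞ θ)
    (hθc : HasCompactSupport θ) {ν : SignedMeasure (Space d)} (hν : AbsCont ν) (β : Fin d → ℕ) :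
    luxNorm e (moll (multiDeriv β θ) ν) ≤
      ENNReal.ofReal ((∫ x, |θ x|) + 1) * weightedDerivNorm e 0 β (density ν) := by
  have hI : 0 ≤ ∫ x, |θ x| := integral_nonneg fun _ => abs_nonneg _
  rw [weightedDerivNorm, ENNReal.mul_iInf_of_ne]
  · refine le_iInf fun g => ?_
    by_cases hg : HasWeakDeriv β (density ν) g
    · rw [iInf_pos hg]
      simp only [Pi.zero_apply, pow_zero, Finset.prod_const_one, one_mul]
      refine (luxNorm_conv_le he hθ.continuous hθc hg.2.1 fun x => ?_).trans ?_
      · rw [moll_multiDeriv_eq hθ hθc hν hg, ← Real.norm_eq_abs]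
        refine (norm_integral_le_integral_norm _).trans (le_of_eq ?_)
        simp only [norm_mul, Real.norm_eq_abs]
      · gcongr
        linarith
    · rw [iInf_neg hg, ENNReal.mul_top]
      · exact le_top
      · simp only [ne_eq, ENNReal.ofReal_eq_zero, not_le]
        positivity
  · simp only [ne_eq, ENNReal.ofReal_eq_zero, not_le]
    positivity
  · exact ENNReal.ofReal_ne_top

theorem weightedDerivNorm_le {k l : ℕ} {β : Fin d → ℕ} (hβ : β ∈ multiIndices d k)
    (f : Space d → ℝ) : weightedDerivNorm e 0 β f ≤ weightedSobolevNorm e k l f := by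
  have h0 : (0 : Fin d → ℕ) ∈ multiIndices d l := mem_multiIndices.2 (by simp)
  exact (Finset.single_le_sum (f := fun α => weightedDerivNorm e 0 α f)
    (fun _ _ => bot_le) hβ).trans
      (Finset.single_le_sum (f := fun γ => ∑ α ∈ multiIndices d k, weightedDerivNorm e γ α f)
        (fun _ _ => bot_le) h0)

/-- The contribution of `μ - ν`, at a scale `r` comparable to `2^n`. -/
theorem exists_luxNorm_moll_sub_le (he : YoungClass e) {K : Space d → ℝ} (hK : ContDiff ℝ ∞ K)
    (hKc : HasCompactSupport K) (k q : ℕ) {α : Fin d → ℕ} (hα : α ∈ multiIndices d q) :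
    ∃ A : ℝ, 0 < A ∧ ∀ (n : ℕ) (r : ℝ), 2 ^ n ≤ r → r ≤ 2 * 2 ^ n →
      ∀ μ ν : SignedMeasure (Space d),
      luxNorm e (fun x => moll (multiDeriv α (dil r K)) μ x - moll (multiDeriv α (dil r K)) ν x) ≤
        ENNReal.ofReal A * (ENNReal.ofReal (2 ^ (n * (q + k)) * youngBeta e (2 ^ (n * d))) *
          measDist k μ ν) := by
  obtain ⟨A, hA, hbd⟩ := exists_moll_sub_bound (contDiff_multiDeriv hK α)
    (hasCompactSupport_multiDeriv hKc α) k
  refine ⟨A * 2 ^ (q + k + d), by positivity, fun n r hr1 hr2 μ ν => ?_⟩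
  have hβ : 0 < youngBeta e (2 ^ (n * d)) := he.youngBeta_pos (by positivity)
  -- at infinite distance the bound is trivial, the coefficient being positive
  rcases eq_or_ne (measDist k μ ν) ⊤ with htop | hfin
  · rw [htop, ENNReal.mul_top, ENNReal.mul_top]
    · exact le_top
    · simp only [ne_eq, ENNReal.ofReal_eq_zero, not_le]; positivity
    · simp only [ne_eq, ENNReal.ofReal_eq_zero, not_le]; positivity
  have hr : 1 ≤ r := (one_le_pow₀ one_le_two).trans hr1
  have hr0 : 0 < r := one_pos.trans_le hr
  obtain ⟨hsup, hint⟩ := hbd r hr μ ν hfin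
  set δ := (measDist k μ ν).toReal with hδ
  have hδ0 : 0 ≤ δ := ENNReal.toReal_nonneg
  set h := fun x => moll (dil r (multiDeriv α K)) μ x - moll (dil r (multiDeriv α K)) ν x with hh
  have hαq : ∑ i, α i ≤ q := mem_multiIndices.1 hα
  have hfun : (fun x => moll (multiDeriv α (dil r K)) μ x - moll (multiDeriv α (dil r K)) ν x) =
      fun x => r ^ (∑ i, α i) * h x := by
    funext x
    simp only [hh, moll, multiDeriv_dil hK, signedInt_const_mul]
    ring
  have hLc := hasCompactSupport_dil (hasCompactSupport_multiDeriv hKc α) hr0.ne'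
  have hL := (contDiff_dil (contDiff_multiDeriv hK α) r).continuous
  have hhc : Continuous h := (continuous_moll hL hLc μ).sub (continuous_moll hL hLc ν)
  -- the factor `2 ^ (q + k + d)` makes up for replacing `r` by `2 ^ n`
  set M : ℝ := A * 2 ^ (q + k + d) * 2 ^ (n * (q + k)) * δ with hM
  have hpow : r ^ (∑ i, α i) * r ^ k ≤ 2 ^ (q + k) * 2 ^ (n * (q + k)) := by
    calc r ^ (∑ i, α i) * r ^ k ≤ r ^ q * r ^ k := by
          gcongr
      _ = r ^ (q + k) := (pow_add _ _ _).symm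
      _ ≤ (2 * 2 ^ n) ^ (q + k) := by gcongr
      _ = _ := by rw [mul_pow, ← pow_mul]
  have hrd : r ^ d ≤ 2 ^ d * 2 ^ (n * d) := by
    calc r ^ d ≤ (2 * 2 ^ n) ^ d := by gcongr
      _ = _ := by rw [mul_pow, ← pow_mul]
  have hpowd : (1 : ℝ) ≤ 2 ^ d := one_le_pow₀ one_le_two
  rw [hfun]
  have key := luxNorm_le_mul_youngBeta he (h := fun x => r ^ (∑ i, α i) * h x) (M := M)
    (R := 2 ^ (n * d)) (hhc.const_mul _).aestronglyMeasurable (by positivity) (by positivity)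
    (fun x => ?_) ?_
  · refine key.trans (le_of_eq ?_)
    rw [← ENNReal.ofReal_toReal hfin, ← hδ, ← ENNReal.ofReal_mul (by positivity),
      ← ENNReal.ofReal_mul (by positivity), hM]
    congr 1
    ring
  · rw [abs_mul, abs_of_pos (by positivity)]
    calc r ^ (∑ i, α i) * |h x| ≤ r ^ (∑ i, α i) * (A * r ^ k * δ * r ^ d) := by
          gcongr; exact hsup x
      _ = A * δ * (r ^ (∑ i, α i) * r ^ k) * r ^ d := by ring
      _ ≤ A * δ * (2 ^ (q + k) * 2 ^ (n * (q + k))) * (2 ^ d * 2 ^ (n * d)) := by gcongr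
      _ = M * 2 ^ (n * d) := by rw [hM, pow_add 2 (q + k) d]; ring
  · simp only [abs_mul, abs_of_pos (pow_pos hr0 _), ENNReal.ofReal_mul (pow_pos hr0 _).le]
    rw [lintegral_const_mul' _ _ ENNReal.ofReal_ne_top]
    calc ENNReal.ofReal (r ^ (∑ i, α i)) * ∫⁻ x, ENNReal.ofReal |h x|
        ≤ ENNReal.ofReal (r ^ (∑ i, α i)) * ENNReal.ofReal (A * r ^ k * δ) := by gcongr
      _ = ENNReal.ofReal (A * δ * (r ^ (∑ i, α i) * r ^ k) * 1) := by
        rw [← ENNReal.ofReal_mul (by positivity)]; congr 1; ring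
      _ ≤ ENNReal.ofReal (A * δ * (2 ^ (q + k) * 2 ^ (n * (q + k))) * 2 ^ d) := by gcongr
      _ = ENNReal.ofReal M := by
        rw [hM, pow_add 2 (q + k) d]
        congr 1
        ring

/-- The dyadic increments of the mollified derivatives `∂_α (K_n * μ)`, starting with
`∂_α (K_0 * μ)` itself. -/
noncomputable def increment (K : Space d → ℝ) (μ : SignedMeasure (Space d)) (α : Fin d → ℕ) :
    ℕ → Space d → ℝ
  | 0 => moll (multiDeriv α (dil (2 ^ 0) K)) μ
  | n + 1 => fun x => moll (multiDeriv α (dil (2 ^ (n + 1)) K)) μ x -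
      moll (multiDeriv α (dil (2 ^ n) K)) μ x

theorem sum_increment (K : Space d → ℝ) (μ : SignedMeasure (Space d)) (α : Fin d → ℕ) (n : ℕ)
    (x : Space d) :
    ∑ j ∈ Finset.range (n + 1), increment K μ α j x = moll (multiDeriv α (dil (2 ^ n) K)) μ x := by
  induction n with
  | zero => simp [increment]
  | succ n ih => rw [Finset.sum_range_succ, ih]; simp [increment]

theorem continuous_moll_multiDeriv_dil {K : Space d → ℝ} (hK : ContDiff ℝ ∞ K)
    (hKc : HasCompactSupport K) (μ : SignedMeasure (Space d)) (α : Fin d → ℕ) (n : ℕ) :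
    Continuous (moll (multiDeriv α (dil (2 ^ n) K)) μ) :=
  continuous_moll (contDiff_multiDeriv (contDiff_dil hK _) α).continuous
    (hasCompactSupport_multiDeriv (hasCompactSupport_dil hKc (by positivity)) α) μ

theorem continuous_increment {K : Space d → ℝ} (hK : ContDiff ℝ ∞ K) (hKc : HasCompactSupport K)
    (μ : SignedMeasure (Space d)) (α : Fin d → ℕ) : ∀ n, Continuous (increment K μ α n)
  | 0 => continuous_moll_multiDeriv_dil hK hKc μ α 0
  | n + 1 => (continuous_moll_multiDeriv_dil hK hKc μ α (n + 1)).sub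
      (continuous_moll_multiDeriv_dil hK hKc μ α n)

/-- The increment of an absolutely continuous measure, with `N` derivatives moved to its density:
each of them gains a factor `2^{-n}`. -/
theorem moll_increment_eq {K : Space d → ℝ} {θ : Fin d → Space d → ℝ} {N : ℕ}
    (hK : ContDiff ℝ ∞ K) (hKc : HasCompactSupport K) (hθ : ∀ i, ContDiff ℝ ∞ (θ i))
    (hθc : ∀ i, HasCompactSupport (θ i))
    (hker : ∀ α x, multiDeriv α (dil 2 K) x - multiDeriv α K x =
        ∑ i, multiDeriv (α + Pi.single i N) (θ i) x)
    (ν : SignedMeasure (Space d)) (α : Fin d → ℕ) (n : ℕ) (x : Space d) :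
    moll (multiDeriv α (dil (2 ^ (n + 1)) K)) ν x - moll (multiDeriv α (dil (2 ^ n) K)) ν x =
      ∑ i, 1 / 2 ^ (n * N) *
        moll (multiDeriv (α + Pi.single i N) (dil (2 ^ n) (θ i))) ν x := by
  have hbd : ∀ {k : Space d → ℝ}, ContDiff ℝ ∞ k → HasCompactSupport k → ∀ (β : Fin d → ℕ) (r : ℝ),
      r ≠ 0 → ∃ B, ∀ y, |multiDeriv β (dil r k) (x - y)| ≤ B := fun hk hkc β r hr => by
    obtain ⟨B, hB⟩ := (contDiff_multiDeriv (contDiff_dil hk r) β).continuous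
      |>.bounded_above_of_compact_support
        (hasCompactSupport_multiDeriv (hasCompactSupport_dil hkc hr) β)
    exact ⟨B, fun y => hB _⟩
  have hct : ∀ {k : Space d → ℝ}, ContDiff ℝ ∞ k → ∀ (β : Fin d → ℕ) (r : ℝ),
      Continuous fun y => multiDeriv β (dil r k) (x - y) := fun hk β r =>
    (contDiff_multiDeriv (contDiff_dil hk r) β).continuous.comp
      (continuous_const.sub continuous_id)
  obtain ⟨B₁, hB₁⟩ := hbd hK hKc α (2 ^ (n + 1)) (by positivity)
  obtain ⟨B₀, hB₀⟩ := hbd hK hKc α (2 ^ n) (by positivity)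
  choose B hB using fun i => hbd (hθ i) (hθc i) (α + Pi.single i N) (2 ^ n) (by positivity)
  simp only [moll]
  rw [← signedInt_sub ν (hct hK α _) hB₁ (hct hK α _) hB₀]
  simp only [← signedInt_const_mul]
  rw [← signedInt_sum ν (fun i => (hct (hθ i) _ _).const_mul _)
    (B := fun i => 1 / 2 ^ (n * N) * B i) fun i y => ?_]
  · congr 1
    funext y
    have hdd : dil (2 ^ (n + 1)) K = dil (2 ^ n) (dil 2 K) := by
      funext z
      simp only [dil, smul_smul, pow_succ, mul_pow]
      rw [mul_comm (2 : ℝ) (2 ^ n)]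
      ring
    have hsum : ∀ i, ∑ j, (α + Pi.single i N : Fin d → ℕ) j = ∑ j, α j + N := fun i => by
      simp [Finset.sum_add_distrib]
    have hdil : ∀ {f : Space d → ℝ}, ContDiff ℝ ∞ f → ∀ β : Fin d → ℕ,
        multiDeriv β (dil (2 ^ n) f) (x - y) = (2 ^ n) ^ (∑ i, β i) *
          ((2 ^ n) ^ d * multiDeriv β f ((2 : ℝ) ^ n • (x - y))) := fun hf β =>
      congrFun (multiDeriv_dil hf (2 ^ n) β) (x - y)
    rw [hdd, hdil (contDiff_dil hK 2), hdil hK, ← mul_sub, ← mul_sub, hker, Finset.mul_sum,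
      Finset.mul_sum]
    refine Finset.sum_congr rfl fun i _ => ?_
    rw [hdil (hθ i), hsum, pow_add ((2 : ℝ) ^ n), ← pow_mul 2 n N]
    field_simp
  · rw [abs_mul, abs_of_pos (by positivity)]
    gcongr
    exact hB i y

end Increments

/-! ### Summing the increments -/

section Sum

variable {d : ℕ} {e : ℝ → ℝ}

/-- The contribution of `ν_n` to the increment. -/
theorem luxNorm_moll_increment_le (he : YoungClass e) {K : Space d → ℝ}
    {θ : Fin d → Space d → ℝ} {m q : ℕ} (hK : ContDiff ℝ ∞ K) (hKc : HasCompactSupport K)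
    (hθ : ∀ i, ContDiff ℝ ∞ (θ i)) (hθc : ∀ i, HasCompactSupport (θ i))
    (hker : ∀ α x, multiDeriv α (dil 2 K) x - multiDeriv α K x =
        ∑ i, multiDeriv (α + Pi.single i (2 * m)) (θ i) x)
    {α : Fin d → ℕ} (hα : ∑ i, α i ≤ q) {ν : SignedMeasure (Space d)} (hν : AbsCont ν) (n : ℕ) :
    luxNorm e (fun x => moll (multiDeriv α (dil (2 ^ (n + 1)) K)) ν x -
        moll (multiDeriv α (dil (2 ^ n) K)) ν x) ≤
      (∑ i, ENNReal.ofReal ((∫ x, |θ i x|) + 1)) * (ENNReal.ofReal (1 / 2 ^ (2 * n * m)) *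
        weightedSobolevNorm e (2 * m + q) (2 * m) (density ν)) := by
  have h2n : (2 : ℝ) ^ n ≠ 0 := by positivity
  have hθm : ∀ i, Continuous
      (moll (multiDeriv (α + Pi.single i (2 * m)) (dil (2 ^ n) (θ i))) ν) := fun i =>
    continuous_moll (contDiff_multiDeriv (contDiff_dil (hθ i) _) _).continuous
      (hasCompactSupport_multiDeriv (hasCompactSupport_dil (hθc i) h2n) _) _
  have hpow : (1 : ℝ) / 2 ^ (2 * n * m) = 1 / 2 ^ (n * (2 * m)) := by
    rw [show 2 * n * m = n * (2 * m) by ring]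
  rw [hpow]
  have hinc := moll_increment_eq hK hKc hθ hθc hker ν α n
  obtain ⟨c, hc⟩ : ∃ c : ℝ, c = 1 / 2 ^ (n * (2 * m)) := ⟨_, rfl⟩
  have hc0 : 0 ≤ c := by rw [hc]; positivity
  rw [← hc] at hinc ⊢
  have hmeas : ∀ i, AEStronglyMeasurable (fun x => c *
      moll (multiDeriv (α + Pi.single i (2 * m)) (dil (2 ^ n) (θ i))) ν x) volume :=
    fun i => ((hθm i).const_mul _).aestronglyMeasurable
  refine (luxNorm_sum_le he hmeas fun x => ?_).trans ?_
  · rw [hinc x]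
    exact Finset.abs_sum_le_sum_abs _ _
  rw [Finset.sum_mul]
  refine Finset.sum_le_sum fun i _ => ?_
  have h3 := luxNorm_moll_multiDeriv_le he (contDiff_dil (hθ i) (2 ^ n))
    (hasCompactSupport_dil (hθc i) h2n) hν (α + Pi.single i (2 * m))
  rw [integral_abs_dil _ (by positivity)] at h3
  have hmem : α + Pi.single i (2 * m) ∈ multiIndices d (2 * m + q) := by
    rw [mem_multiIndices]
    simp only [Pi.add_apply, Finset.sum_add_distrib, Finset.sum_pi_single', Finset.mem_univ,
      if_true]
    omega
  have h4 := weightedDerivNorm_le (e := e) (l := 2 * m) hmem (density ν)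
  rw [mul_left_comm]
  exact (luxNorm_const_mul_le he hc0 _).trans
    (mul_le_mul' le_rfl (h3.trans (mul_le_mul' le_rfl h4)))

/-- The increments of the mollified derivatives of `μ` are bounded by the balance with respect to
any approximating sequence. -/
theorem exists_tsum_luxNorm_increment_le (he : YoungClass e) {K : Space d → ℝ}
    {θ : Fin d → Space d → ℝ} {m : ℕ} (hK : ContDiff ℝ ∞ K) (hKc : HasCompactSupport K)
    (hθ : ∀ i, ContDiff ℝ ∞ (θ i)) (hθc : ∀ i, HasCompactSupport (θ i))
    (hker : ∀ α x, multiDeriv α (dil 2 K) x - multiDeriv α K x =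
        ∑ i, multiDeriv (α + Pi.single i (2 * m)) (θ i) x)
    (q k : ℕ) {α : Fin d → ℕ} (hα : α ∈ multiIndices d q) :
    ∃ C : ℝ≥0, ∀ (μ : SignedMeasure (Space d)) (ν : ℕ → SignedMeasure (Space d)),
      (∀ n, AbsCont (ν n)) →
      ∑' n, luxNorm e (increment K μ α n) ≤ C * balance q k m e μ ν := by
  obtain ⟨A, hA, hAbd⟩ := exists_luxNorm_moll_sub_le he hK hKc k q hα
  set D₀ : ℝ≥0∞ := ENNReal.ofReal ((∫ x, |K x|) + 1) with hD₀
  set D₁ : ℝ≥0∞ := ∑ i, ENNReal.ofReal ((∫ x, |θ i x|) + 1) with hD₁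
  set A' : ℝ≥0∞ := ENNReal.ofReal A with hA'
  have hCfin : A' + 2 * A' + (D₀ + D₁) ≠ ⊤ := by
    have h1 : D₁ ≠ ⊤ := ENNReal.sum_ne_top.2 fun i _ => ENNReal.ofReal_ne_top
    finiteness
  refine ⟨(A' + 2 * A' + (D₀ + D₁)).toNNReal, fun μ ν hν => ?_⟩
  rw [ENNReal.coe_toNNReal hCfin]
  set T : ℕ → ℝ≥0∞ := fun n => ENNReal.ofReal (2 ^ (n * (q + k)) * youngBeta e (2 ^ (n * d))) *
    measDist k μ (ν n) with hT
  set W : ℕ → ℝ≥0∞ := fun n => weightedSobolevNorm e (2 * m + q) (2 * m) (density (ν n)) with hW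
  set V : ℕ → ℝ≥0∞ := fun n => ENNReal.ofReal (1 / 2 ^ (2 * n * m)) * W n with hV
  have hcm : ∀ (r : ℝ), r ≠ 0 → ∀ σ : SignedMeasure (Space d),
      Continuous (moll (multiDeriv α (dil r K)) σ) := fun r hr σ =>
    continuous_moll (contDiff_multiDeriv (contDiff_dil hK _) α).continuous
      (hasCompactSupport_multiDeriv (hasCompactSupport_dil hKc hr) α) σ
  have hsub : ∀ (r : ℝ), r ≠ 0 → ∀ σ τ : SignedMeasure (Space d), AEStronglyMeasurable (fun x =>
      moll (multiDeriv α (dil r K)) σ x - moll (multiDeriv α (dil r K)) τ x) volume :=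
    fun r hr σ τ => ((hcm r hr σ).sub (hcm r hr τ)).aestronglyMeasurable
  have hW1 : ∀ n (β : Fin d → ℕ), ∑ i, β i ≤ 2 * m + q →
      weightedDerivNorm e 0 β (density (ν n)) ≤ W n := fun n β hβ =>
    weightedDerivNorm_le (mem_multiIndices.2 hβ) _
  have hαq : ∑ i, α i ≤ q := mem_multiIndices.1 hα
  have hzero : luxNorm e (increment K μ α 0) ≤ A' * T 0 + D₀ * V 0 := by
    refine (luxNorm_add_le he (hsub (2 ^ 0) (by positivity) μ (ν 0))
      (hcm (2 ^ 0) (by positivity) (ν 0)).aestronglyMeasurable fun x => ?_).trans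
      (add_le_add (hAbd 0 (2 ^ 0) le_rfl (by norm_num) μ (ν 0)) ?_)
    · simp only [increment]
      have := abs_add_le (moll (multiDeriv α (dil (2 ^ 0) K)) μ x -
        moll (multiDeriv α (dil (2 ^ 0) K)) (ν 0) x) (moll (multiDeriv α (dil (2 ^ 0) K)) (ν 0) x)
      rwa [sub_add_cancel] at this
    · refine (luxNorm_moll_multiDeriv_le he (contDiff_dil hK _)
        (hasCompactSupport_dil hKc (by positivity)) (hν 0) α).trans ?_
      rw [integral_abs_dil _ (by positivity)]
      have hV0 : V 0 = W 0 := by simp [hV]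
      rw [hV0]
      gcongr
      exact hW1 0 α (by omega)
  have hsucc : ∀ n, luxNorm e (increment K μ α (n + 1)) ≤ 2 * A' * T n + D₁ * V n := fun n => by
    have h2n : (2 : ℝ) ^ n ≠ 0 := by positivity
    have h2n1 : (2 : ℝ) ^ (n + 1) ≠ 0 := by positivity
    -- the increment of `μ` is `u₁ - u₀ + v`
    set u₁ := fun x => moll (multiDeriv α (dil (2 ^ (n + 1)) K)) μ x -
      moll (multiDeriv α (dil (2 ^ (n + 1)) K)) (ν n) x with hu₁
    set u₀ := fun x => moll (multiDeriv α (dil (2 ^ n) K)) μ x -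
      moll (multiDeriv α (dil (2 ^ n) K)) (ν n) x with hu₀
    set v := fun x => moll (multiDeriv α (dil (2 ^ (n + 1)) K)) (ν n) x -
      moll (multiDeriv α (dil (2 ^ n) K)) (ν n) x with hv
    have hvm : AEStronglyMeasurable v volume :=
      ((hcm _ h2n1 (ν n)).sub (hcm _ h2n (ν n))).aestronglyMeasurable
    have hum : AEStronglyMeasurable (fun x => u₁ x - u₀ x) volume :=
      (hsub _ h2n1 μ (ν n)).sub (hsub _ h2n μ (ν n))
    have h1 : luxNorm e (fun x => u₁ x - u₀ x) ≤ A' * T n + A' * T n :=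
      (luxNorm_add_le he (hsub _ h2n1 μ (ν n)) (hsub _ h2n μ (ν n))
        fun x => abs_sub (u₁ x) (u₀ x)).trans (add_le_add
          (hAbd n _ (pow_le_pow_right₀ one_le_two n.le_succ) (by rw [pow_succ, mul_comm]) μ (ν n))
          (hAbd n _ le_rfl (by linarith [pow_pos (two_pos (α := ℝ)) n]) μ (ν n)))
    have h2 : luxNorm e v ≤ D₁ * V n :=
      luxNorm_moll_increment_le he hK hKc hθ hθc hker hαq (hν n) n
    refine (luxNorm_add_le he hum hvm fun x => ?_).trans ((add_le_add h1 h2).trans (le_of_eq ?_))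
    · refine le_trans (le_of_eq ?_) (abs_add_le _ _)
      simp only [increment, hu₁, hu₀, hv]
      congr 1
      ring
    · ring
  have hT0 : T 0 ≤ ∑' n, T n := ENNReal.le_tsum 0
  have hV0 : V 0 ≤ ∑' n, V n := ENNReal.le_tsum 0
  rw [tsum_eq_zero_add' ENNReal.summable]
  calc luxNorm e (increment K μ α 0) + ∑' n, luxNorm e (increment K μ α (n + 1))
      ≤ (A' * ∑' n, T n + D₀ * ∑' n, V n) + ∑' n, (2 * A' * T n + D₁ * V n) := by
        refine add_le_add (hzero.trans ?_) (ENNReal.tsum_le_tsum hsucc)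
        gcongr
    _ = (A' + 2 * A') * ∑' n, T n + (D₀ + D₁) * ∑' n, V n := by
        rw [ENNReal.tsum_add, ENNReal.tsum_mul_left, ENNReal.tsum_mul_left]
        ring
    _ ≤ (A' + 2 * A' + (D₀ + D₁)) * ∑' n, T n + (A' + 2 * A' + (D₀ + D₁)) * ∑' n, V n := by
        exact add_le_add (mul_le_mul' le_self_add le_rfl) (mul_le_mul' le_add_self le_rfl)
    _ = (A' + 2 * A' + (D₀ + D₁)) * balance q k m e μ ν := by
        rw [← mul_add]
        rfl

/-- The mollified derivative as a distribution. -/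
theorem integral_moll_multiDeriv_mul {K φ : Space d → ℝ} (hK : ContDiff ℝ ∞ K)
    (hKc : HasCompactSupport K) (hφ : ContDiff ℝ ∞ φ) (hφc : HasCompactSupport φ)
    (μ : SignedMeasure (Space d)) (α : Fin d → ℕ) :
    ∫ x, moll (multiDeriv α K) μ x * φ x =
      (-1) ^ (∑ i, α i) * signedInt μ (corr K (multiDeriv α φ)) := by
  rw [integral_moll_mul (contDiff_multiDeriv hK α).continuous (hasCompactSupport_multiDeriv hKc α)
    (hφ.continuous.integrable_of_hasCompactSupport hφc), ← signedInt_const_mul]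
  congr 1
  funext y
  exact corr_multiDeriv hK hKc hφ hφc α y

theorem tendsto_signedInt_corr_dil {K g : Space d → ℝ} (hK : ContDiff ℝ ∞ K)
    (hKc : HasCompactSupport K) (hK1 : ∫ x, K x = 1) (hg : Continuous g)
    (hgc : HasCompactSupport g) (μ : SignedMeasure (Space d)) :
    Filter.Tendsto (fun n : ℕ => signedInt μ (corr (dil (2 ^ n) K) g)) Filter.atTop
      (nhds (signedInt μ g)) := by
  obtain ⟨B, hB⟩ := hg.bounded_above_of_compact_support hgc
  have hlim : ∀ a : Measure (Space d), IsFiniteMeasure a →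
      Filter.Tendsto (fun n : ℕ => ∫ y, corr (dil (2 ^ n) K) g y ∂a) Filter.atTop
        (nhds (∫ y, g y ∂a)) := fun a _ => by
    refine tendsto_integral_of_dominated_convergence (fun _ => B * ∫ x, |K x|) (fun n => ?_)
      (integrable_const _) (fun n => .of_forall fun y => ?_) (.of_forall fun y => ?_)
    · exact (contDiff_corr (contDiff_dil hK _) (hasCompactSupport_dil hKc (by positivity))
        hg.locallyIntegrable).continuous.aestronglyMeasurable
    · rw [← integral_abs_dil K (r := 2 ^ n) (by positivity)]
      exact abs_corr_le (contDiff_dil hK _).continuous (hasCompactSupport_dil hKc (by positivity))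
        hB y
    · exact tendsto_corr_dil hK.continuous hKc hK1 hg hB y
  exact (hlim _ inferInstance).sub (hlim _ inferInstance)

/-- If the increments of the mollified derivatives `∂_α (K_n * μ)` are summable in the Luxemburg
norm, their sum is a function representing the distributional derivative `∂_α μ`. -/
theorem exists_distribDeriv (he : YoungClass e) {K : Space d → ℝ} (hK : ContDiff ℝ ∞ K)
    (hKc : HasCompactSupport K) (hK1 : ∫ x, K x = 1) (μ : SignedMeasure (Space d))
    (α : Fin d → ℕ) (hfin : ∑' n, luxNorm e (increment K μ α n) < ⊤) :
    ∃ f : Space d → ℝ, LocallyIntegrable f volume ∧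
      luxNorm e f ≤ ∑' n, luxNorm e (increment K μ α n) ∧
      ∀ φ : Space d → ℝ, ContDiff ℝ ∞ φ → HasCompactSupport φ →
        ∫ x, f x * φ x = (-1) ^ (∑ i, α i) * signedInt μ (multiDeriv α φ) := by
  have hc := continuous_increment hK hKc μ α
  have hm : ∀ n, AEStronglyMeasurable (increment K μ α n) volume :=
    fun n => (hc n).aestronglyMeasurable
  have hsum := ae_summable_of_tsum_luxNorm_lt_top he hm hfin
  set H : Space d → ℝ := fun x => ∑' n, |increment K μ α n x| with hH
  set f : Space d → ℝ := fun x => ∑' n, increment K μ α n x with hf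
  have hHm : AEStronglyMeasurable H volume :=
    (Measurable.aemeasurable (Measurable.tsum fun n => (hc n).abs.measurable)).aestronglyMeasurable
  have hfm : AEStronglyMeasurable f volume :=
    (Measurable.aemeasurable (Measurable.tsum fun n => (hc n).measurable)).aestronglyMeasurable
  have hH0 : ∀ x, 0 ≤ H x := fun x => tsum_nonneg fun n => abs_nonneg _
  have hHlux : luxNorm e H ≤ ∑' n, luxNorm e (increment K μ α n) := by
    refine luxNorm_le_tsum he hm ?_
    filter_upwards [hsum] with x hx
    rw [abs_of_nonneg (hH0 x), hH, ENNReal.ofReal_tsum_of_nonneg (fun n => abs_nonneg _) hx]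
  have hfH : ∀ᵐ x, |f x| ≤ |H x| := by
    filter_upwards [hsum] with x hx
    rw [abs_of_nonneg (hH0 x)]
    exact norm_tsum_le_tsum_norm (f := fun n => increment K μ α n x) hx
  have hflux : luxNorm e f ≤ ∑' n, luxNorm e (increment K μ α n) :=
    (luxNorm_mono he hfH).trans hHlux
  have hHloc := locallyIntegrable_of_luxNorm_lt_top he hHm (hHlux.trans_lt hfin)
  have hfloc := locallyIntegrable_of_luxNorm_lt_top he hfm (hflux.trans_lt hfin)
  refine ⟨f, hfloc, hflux, fun φ hφ hφc => ?_⟩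
  have hleft : Filter.Tendsto (fun n : ℕ => ∫ x, moll (multiDeriv α (dil (2 ^ n) K)) μ x * φ x)
      Filter.atTop (nhds (∫ x, f x * φ x)) := by
    refine tendsto_integral_of_dominated_convergence (fun x => |φ x| * H x) (fun n => ?_) ?_
      (fun n => ?_) ?_
    · exact ((continuous_moll_multiDeriv_dil hK hKc μ α n).mul
        hφ.continuous).aestronglyMeasurable
    · exact hHloc.integrable_smul_left_of_hasCompactSupport hφ.continuous.abs
        (hφc.comp_left (g := fun t : ℝ => |t|) abs_zero)
    · filter_upwards [hsum] with x hx
      rw [Real.norm_eq_abs, abs_mul, mul_comm, ← sum_increment]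
      gcongr
      exact (Finset.abs_sum_le_sum_abs _ _).trans (hx.sum_le_tsum _ fun _ _ => abs_nonneg _)
    · filter_upwards [hsum] with x hx
      have h1 := (hx.of_abs.hasSum.tendsto_sum_nat.comp (Filter.tendsto_add_atTop_nat 1)).mul_const
        (φ x)
      simpa only [Function.comp_def, sum_increment] using h1
  have hφα := contDiff_multiDeriv hφ α
  have hright := (tendsto_signedInt_corr_dil hK hKc hK1 hφα.continuous
    (hasCompactSupport_multiDeriv hφc α) μ).const_mul ((-1) ^ (∑ i, α i))
  refine tendsto_nhds_unique hleft (hright.congr fun n => ?_)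
  exact (integral_moll_multiDeriv_mul (contDiff_dil hK _)
    (hasCompactSupport_dil hKc (by positivity)) hφ hφc μ α).symm

end Sum

/-! ### Signed measures given by locally integrable functions -/

section Density

variable {d : ℕ}

theorem isFiniteMeasureOnCompacts_add (A B : Measure (Space d)) [IsFiniteMeasureOnCompacts A]
    [IsFiniteMeasureOnCompacts B] : IsFiniteMeasureOnCompacts (A + B) :=
  ⟨fun _ hS => by
    rw [Measure.add_apply]
    exact ENNReal.add_lt_top.2 ⟨hS.measure_lt_top, hS.measure_lt_top⟩⟩

/-- Measures that are finite on compact sets and agree on test functions are equal: their densities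
with respect to the sum of the two measures agree. -/
theorem measure_ext_of_integral_contDiff {A B : Measure (Space d)} [IsFiniteMeasureOnCompacts A]
    [IsFiniteMeasureOnCompacts B]
    (h : ∀ φ : Space d → ℝ, ContDiff ℝ ∞ φ → HasCompactSupport φ →
      ∫ x, φ x ∂A = ∫ x, φ x ∂B) : A = B := by
  set Λ := A + B with hΛ
  have := isFiniteMeasureOnCompacts_add A B
  have hAΛ : A ≤ Λ := Measure.le_add_right le_rfl
  have hBΛ : B ≤ Λ := Measure.le_add_left le_rfl
  have hloc : ∀ D : Measure (Space d), D ≤ Λ →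
      LocallyIntegrable (fun x => (D.rnDeriv Λ x).toReal) Λ := fun D hD => by
    refine (locallyIntegrable_const (1 : ℝ)).mono
      (Measure.measurable_rnDeriv D Λ).ennreal_toReal.aestronglyMeasurable ?_
    filter_upwards [Measure.rnDeriv_le_one_of_le hD] with x hx
    simpa using ENNReal.toReal_mono ENNReal.one_ne_top hx
  have hae := ae_eq_of_integral_contDiff_smul_eq (hloc A hAΛ) (hloc B hBΛ) fun φ hφ hφc => by
    have := h φ hφ hφc
    rw [← integral_rnDeriv_smul (Measure.absolutelyContinuous_of_le hAΛ),
      ← integral_rnDeriv_smul (Measure.absolutelyContinuous_of_le hBΛ)] at this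
    simpa only [smul_eq_mul, mul_comm] using this
  rw [← Measure.withDensity_rnDeriv_eq A Λ (Measure.absolutelyContinuous_of_le hAΛ),
    ← Measure.withDensity_rnDeriv_eq B Λ (Measure.absolutelyContinuous_of_le hBΛ)]
  refine withDensity_congr_ae ?_
  filter_upwards [hae, Measure.rnDeriv_lt_top A Λ, Measure.rnDeriv_lt_top B Λ] with x hx h1 h2
  exact (ENNReal.toReal_eq_toReal_iff' h1.ne h2.ne).1 hx

theorem isFiniteMeasureOnCompacts_withDensity_ofReal {f : Space d → ℝ}
    (hf : LocallyIntegrable f volume) :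
    IsFiniteMeasureOnCompacts (volume.withDensity fun x => ENNReal.ofReal (f x)) := by
  refine ⟨fun S hS => ?_⟩
  rw [withDensity_apply _ hS.measurableSet]
  refine (lintegral_mono fun x => ?_).trans_lt (hf.integrableOn_isCompact hS).2
  rw [Real.enorm_eq_ofReal_abs]
  exact ENNReal.ofReal_le_ofReal (le_abs_self _)

/-- A finite signed measure that is given on test functions by a locally integrable `f` is
absolutely continuous. Integrability of `f` is not known beforehand, so the
negative parts are moved across the equation to compare positive measures. -/
theorem absCont_of_integral_eq {μ : SignedMeasure (Space d)} {f : Space d → ℝ}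
    (hf : LocallyIntegrable f volume)
    (h : ∀ φ : Space d → ℝ, ContDiff ℝ ∞ φ → HasCompactSupport φ →
      ∫ x, f x * φ x = signedInt μ φ) : AbsCont μ := by
  have hfin := isFiniteMeasureOnCompacts_withDensity_ofReal hf
  have hfinn := isFiniteMeasureOnCompacts_withDensity_ofReal hf.neg
  set P := μ.toJordanDecomposition.posPart with hP
  set N := μ.toJordanDecomposition.negPart with hN
  have hmP : AEMeasurable (fun x => ENNReal.ofReal (f x)) volume :=
    hf.aestronglyMeasurable.aemeasurable.ennreal_ofReal
  have hmN : AEMeasurable (fun x => ENNReal.ofReal ((-f) x)) volume :=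
    hf.neg.aestronglyMeasurable.aemeasurable.ennreal_ofReal
  have heq : P + volume.withDensity (fun x => ENNReal.ofReal ((-f) x)) =
      N + volume.withDensity (fun x => ENNReal.ofReal (f x)) := by
    have := isFiniteMeasureOnCompacts_add P (volume.withDensity fun x => ENNReal.ofReal ((-f) x))
    have := isFiniteMeasureOnCompacts_add N (volume.withDensity fun x => ENNReal.ofReal (f x))
    refine measure_ext_of_integral_contDiff fun φ hφ hφc => ?_
    have hi : ∀ D : Measure (Space d), IsFiniteMeasureOnCompacts D → Integrable φ D :=
      fun D _ => hφ.continuous.integrable_of_hasCompactSupport hφc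
    have hi1 := hi _ hfin
    have hi2 := hi _ hfinn
    have hdiff : ∫ x, φ x ∂(volume.withDensity fun x => ENNReal.ofReal (f x)) -
        ∫ x, φ x ∂(volume.withDensity fun x => ENNReal.ofReal ((-f) x)) = ∫ x, f x * φ x := by
      rw [integrable_withDensity_iff_integrable_smul₀' hmP
        (.of_forall fun _ => ENNReal.ofReal_lt_top)] at hi1
      rw [integrable_withDensity_iff_integrable_smul₀' hmN
        (.of_forall fun _ => ENNReal.ofReal_lt_top)] at hi2
      rw [integral_withDensity_eq_integral_toReal_smul₀ hmP
        (.of_forall fun _ => ENNReal.ofReal_lt_top),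
        integral_withDensity_eq_integral_toReal_smul₀ hmN
        (.of_forall fun _ => ENNReal.ofReal_lt_top), ← integral_sub hi1 hi2]
      refine integral_congr_ae (.of_forall fun x => ?_)
      simp only [ENNReal.toReal_ofReal', smul_eq_mul, ← sub_mul, Pi.neg_apply]
      rw [max_zero_sub_max_neg_zero_eq_self]
    have := h φ hφ hφc
    rw [integral_add_measure (hi P inferInstance) (hi _ hfinn),
      integral_add_measure (hi N inferInstance) (hi _ hfin)]
    rw [signedInt, ← hdiff] at this
    linarith
  refine VectorMeasure.AbsolutelyContinuous.mk fun s hs hs0 => ?_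
  rw [Measure.toENNRealVectorMeasure_apply_measurable hs] at hs0
  have hPN : P s = N s := by
    have := congrArg (fun D : Measure (Space d) => D s) heq
    simpa only [Measure.add_apply, withDensity_absolutelyContinuous _ _ hs0, add_zero] using this
  rw [← μ.toSignedMeasure_toJordanDecomposition, JordanDecomposition.toSignedMeasure,
    sub_apply, Measure.toSignedMeasure_apply_measurable hs,
    Measure.toSignedMeasure_apply_measurable hs, measureReal_def, measureReal_def, ← hP, ← hN, hPN,
    sub_self]

theorem density_ae_eq {μ : SignedMeasure (Space d)} (hμ : AbsCont μ) {f : Space d → ℝ}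
    (hf : LocallyIntegrable f volume)
    (h : ∀ φ : Space d → ℝ, ContDiff ℝ ∞ φ → HasCompactSupport φ →
      ∫ x, f x * φ x = signedInt μ φ) : density μ =ᵐ[volume] f := by
  refine ae_eq_of_integral_contDiff_smul_eq
    (SignedMeasure.integrable_rnDeriv μ volume).locallyIntegrable hf fun φ hφ hφc => ?_
  obtain ⟨B, hB⟩ := hφ.continuous.bounded_above_of_compact_support hφc
  have := h φ hφ hφc
  rw [signedInt_eq_integral_density hμ hφ.continuous hB] at this
  simpa only [smul_eq_mul, mul_comm] using this.symm

end Density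

end OrliczCriterion

/-! ### The regularity criterion -/

open OrliczCriterion
theorem mainTheorem2 (d q k m : ℕ) (hm : 1 ≤ m) (e : ℝ → ℝ) (he : YoungClass e) :
    ∃ C : ℝ≥0, ∀ μ ∈ approxClass d q k m e,
      AbsCont μ ∧
      density μ ∈ sobolevSpace d e q ∧
      sobolevNorm e q (density μ) ≤ C * rho q k m e μ ∧
      (q = 0 → density μ ∈ orliczSpace d e ∧ luxNorm e (density μ) ≤ C * rho q k m e μ) := by
  obtain ⟨K, θ, hK, hKc, hK1, hθ, hθc, hker⟩ := exists_kernel d (2 * m)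
  have hstep : ∀ α : Fin d → ℕ, ∃ C : ℝ≥0, α ∈ multiIndices d q →
      ∀ μ : SignedMeasure (Space d),
      ∑' n, luxNorm e (increment K μ α n) ≤ C * rho q k m e μ := fun α => by
    by_cases hα : α ∈ multiIndices d q
    · obtain ⟨C, hC⟩ := exists_tsum_luxNorm_increment_le he hK hKc hθ hθc hker q k hα
      -- a positive constant may be moved into the infimum
      refine ⟨C + 1, fun _ μ => ?_⟩
      have hne : ((C + 1 : ℝ≥0) : ℝ≥0∞) ≠ 0 := by simp
      rw [rho, ENNReal.mul_iInf_of_ne hne ENNReal.coe_ne_top]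
      refine le_iInf fun ν => ?_
      rw [ENNReal.mul_iInf_of_ne hne ENNReal.coe_ne_top]
      refine le_iInf fun hν => (hC μ ν hν).trans ?_
      gcongr
      exact le_self_add
    · exact ⟨0, fun h => absurd h hα⟩
  choose C hC using hstep
  have hzero : (0 : Fin d → ℕ) ∈ multiIndices d q := mem_multiIndices.2 (by simp)
  refine ⟨∑ α ∈ multiIndices d q, C α, fun μ hμ => ?_⟩
  have hρ : rho q k m e μ < ⊤ := hμ
  have hfun : ∀ α ∈ multiIndices d q, ∃ f : Space d → ℝ, LocallyIntegrable f volume ∧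
      luxNorm e f ≤ C α * rho q k m e μ ∧
      ∀ φ : Space d → ℝ, ContDiff ℝ ∞ φ → HasCompactSupport φ →
        ∫ x, f x * φ x = (-1) ^ (∑ i, α i) * signedInt μ (multiDeriv α φ) := fun α hα => by
    obtain ⟨f, h1, h2, h3⟩ := exists_distribDeriv he hK hKc hK1 μ α
      ((hC α hα μ).trans_lt (ENNReal.mul_lt_top ENNReal.coe_lt_top hρ))
    exact ⟨f, h1, h2.trans (hC α hα μ), h3⟩
  obtain ⟨f₀, hf₀, hlux₀, hint₀⟩ := hfun 0 hzero
  have hint₀' : ∀ φ : Space d → ℝ, ContDiff ℝ ∞ φ → HasCompactSupport φ →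
      ∫ x, f₀ x * φ x = signedInt μ φ := fun φ hφ hφc => by
    rw [hint₀ φ hφ hφc]
    simp [multiDeriv]
  have hac : AbsCont μ := absCont_of_integral_eq hf₀ hint₀'
  have hdens := density_ae_eq hac hf₀ hint₀'
  have hderiv : ∀ α ∈ multiIndices d q,
      weightedDerivNorm e 0 α (density μ) ≤ C α * rho q k m e μ := fun α hα => by
    obtain ⟨f, hf, hlux, hint⟩ := hfun α hα
    have hweak : HasWeakDeriv α (density μ) f := by
      refine ⟨(SignedMeasure.integrable_rnDeriv μ volume).locallyIntegrable, hf,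
        fun φ hφ hφc => ?_⟩
      have hφα := contDiff_multiDeriv hφ α
      obtain ⟨B, hB⟩ := hφα.continuous.bounded_above_of_compact_support
        (hasCompactSupport_multiDeriv hφc α)
      rw [hint φ hφ hφc, signedInt_eq_integral_density hac hφα.continuous hB, ← mul_assoc,
        ← mul_pow]
      simp [mul_comm]
    refine (iInf₂_le f hweak).trans (le_trans (le_of_eq ?_) hlux)
    simp
  have hsob : sobolevNorm e q (density μ) ≤
      ((∑ α ∈ multiIndices d q, C α : ℝ≥0) : ℝ≥0∞) * rho q k m e μ := by
    rw [sobolevNorm, ENNReal.ofNNReal_finsetSum, Finset.sum_mul]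
    exact Finset.sum_le_sum hderiv
  have hlux : luxNorm e (density μ) ≤
      ((∑ α ∈ multiIndices d q, C α : ℝ≥0) : ℝ≥0∞) * rho q k m e μ := by
    rw [luxNorm_congr he hdens]
    refine hlux₀.trans ?_
    gcongr
    exact Finset.single_le_sum (f := C) (fun _ _ => bot_le) hzero
  have htop : ((∑ α ∈ multiIndices d q, C α : ℝ≥0) : ℝ≥0∞) * rho q k m e μ < ⊤ :=
    ENNReal.mul_lt_top ENNReal.coe_lt_top hρ
  exact ⟨hac, hsob.trans_lt htop, hsob, fun _ =>
    ⟨⟨(SignedMeasure.integrable_rnDeriv μ volume).aestronglyMeasurable, hlux.trans_lt htop⟩, hlux⟩⟩
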